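/- Access points (APs) form a homogeneous Poisson point process $\phi$ of intensity $\lambda>0$ on $\mathbb{R}^2$, and the user is at the origin. An AP at $z$ is in visibility state $v=L$ (line of sight) if $\|z\|\le d$ and in state $v=N$ if $\|z\|>d$, where $d>0$ is fixed. In the sub-6GHz band $s$ let $K_s>0$ be the path-loss constant, $P_s>0$ the transmit power, $\alpha_{Ls},\alpha_{Ns}>0$ the path-loss exponents and $\sigma^2_{N,s}\ge 0$ the noise power. An AP at $z$ in state $v$ has mean received power $K_sP_s\|z\|^{-\alpha_{vs}}$ and path loss $\xi(z)=\|z\|^{\alpha_{vs}}/(K_sP_s)$. Let $\Lambda'_{vs}$ be the intensity measure of the process of the path losses of the APs in state $v$. The link to each AP has a fading gain; the fading gains are i.i.d. exponential with mean $1$ and independent of $\phi$ (Rayleigh fading). The power received from an AP is its fading gain times its mean received power. The user is served by the AP with the largest mean received power, all other APs interfere, and the SINR is the power received from the serving AP divided by the sum of $\sigma^2_{N,s}$ and the total power received from the other APs. Let $\gamma>0$. Given that the serving AP has path loss $x$ and visibility state $v\in\{L,N\}$, the SINR coverage probability is $$\mathbb{P}(\mathrm{SINR}>\gamma\mid x,v)=\exp\Bigl(-\gamma\,\sigma^2_{N,s}\,x-\sum_{v'\in\{L,N\}}A_{v'}(\gamma,x)\Bigr),\qquad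 A_{v'}(\gamma,x)=\int_x^\infty\frac{\gamma x}{y+\gamma x}\,\Lambda'_{v's}(dy),$$ for almost every $(x,v)$ with respect to the joint law of the path loss and the visibility state of the serving AP (the right-hand side being $0$ if one of the integrals diverges). -/

import Mathlib

open MeasureTheory ProbabilityTheory Set
open scoped ENNReal NNReal

/-- Visibility state of an access point (AP): line of sight or non line of sight. -/
inductive Visibility where
  | L
  | N
deriving DecidableEq

instance : Fintype Visibility := ⟨{.L, .N}, fun v => by cases v <;> decide⟩

instance : MeasurableSpace Visibility := ⊤

/-- The Euclidean plane. -/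
abbrev Plane : Type := EuclideanSpace ℝ (Fin 2)

/-- The number of points of the family `Z` that lie in `B`. -/
noncomputable def pointCount {Ω E : Type*} (Z : ℕ → Ω → E) (B : Set E) (ω : Ω) : ℕ∞ :=
  Set.encard {i : ℕ | Z i ω ∈ B}

/-- The random points `Z 0, Z 1, …` form a Poisson point process with intensity measure `Λ`:
the number of points in a measurable set of finite `Λ`-measure is Poisson distributed with mean
its `Λ`-measure, and the numbers of points in pairwise disjoint such sets are independent. -/
structure IsPoissonPointProcess {Ω E : Type*} [MeasurableSpace Ω] [MeasurableSpace E]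
    (Z : ℕ → Ω → E) (Λ : Measure E) (P : Measure Ω) : Prop where
  measurable_point : ∀ i, Measurable (Z i)
  law_count : ∀ B : Set E, MeasurableSet B → Λ B ≠ ∞ → ∀ n : ℕ,
    P {ω | pointCount Z B ω = n} = poissonMeasure (Λ B).toNNReal {n}
  indep_count : ∀ (k : ℕ) (B : Fin k → Set E), (∀ j, MeasurableSet (B j)) →
    (∀ j, Λ (B j) ≠ ∞) → Pairwise (fun j l => Disjoint (B j) (B l)) →
    iIndepFun (fun j => pointCount Z (B j)) P

/-- Parameters of the network in the sub-6GHz band. -/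
structure Sub6Network where
  /-- number of APs per unit area -/
  density : ℝ
  /-- radius of the LOS ball -/
  losRadius : ℝ
  /-- path-loss exponent in each visibility state -/
  exponent : Visibility → ℝ
  /-- path-loss constant `K` -/
  gain : ℝ
  /-- transmit power -/
  txPower : ℝ
  /-- noise power `σ²` -/
  noise : ℝ
  density_pos : 0 < density
  losRadius_pos : 0 < losRadius
  exponent_pos : ∀ v, 0 < exponent v
  gain_pos : 0 < gain
  txPower_pos : 0 < txPower
  noise_nonneg : 0 ≤ noise

namespace Sub6Network

variable (S : Sub6Network)

/-- Visibility state of an AP at `z`, seen from the user at the origin. -/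
noncomputable def visibility (z : Plane) : Visibility :=
  if ‖z‖ ≤ S.losRadius then .L else .N

/-- Path loss `‖z‖ ^ α / (K P)` of an AP at `z`. -/
noncomputable def pathLoss (z : Plane) : ℝ :=
  ‖z‖ ^ S.exponent (S.visibility z) / (S.gain * S.txPower)

/-- Mean received power `K P ‖z‖ ^ (-α)` from an AP at `z`. -/
noncomputable def meanPower (z : Plane) : ℝ :=
  S.gain * S.txPower * ‖z‖ ^ (-S.exponent (S.visibility z))

variable {Ω : Type*}

/-- Index of the serving AP, the one with the strongest mean received power (ties, which have
probability zero, are broken by the smallest index). -/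
noncomputable def serving (Z : ℕ → Ω → Plane) (ω : Ω) : ℕ :=
  sInf {i : ℕ | ∀ j, S.meanPower (Z j ω) ≤ S.meanPower (Z i ω)}

/-- Path loss of the serving AP. -/
noncomputable def servingPathLoss (Z : ℕ → Ω → Plane) (ω : Ω) : ℝ :=
  S.pathLoss (Z (S.serving Z ω) ω)

/-- Visibility state of the serving AP. -/
noncomputable def servingVisibility (Z : ℕ → Ω → Plane) (ω : Ω) : Visibility :=
  S.visibility (Z (S.serving Z ω) ω)

/-- Instantaneous power received from the `i`-th AP, whose fading gain is `h i`. -/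
noncomputable def power (Z : ℕ → Ω → Plane) (h : ℕ → Ω → ℝ) (i : ℕ) (ω : Ω) : ℝ≥0∞ :=
  ENNReal.ofReal (h i ω * S.meanPower (Z i ω))

/-- Total power received from all the APs other than the serving one. -/
noncomputable def interference (Z : ℕ → Ω → Plane) (h : ℕ → Ω → ℝ) (ω : Ω) : ℝ≥0∞ :=
  ∑' i : ℕ, if i = S.serving Z ω then 0 else S.power Z h i ω

/-- Signal-to-interference-plus-noise ratio of the user. -/
noncomputable def sinr (Z : ℕ → Ω → Plane) (h : ℕ → Ω → ℝ) (ω : Ω) : ℝ≥0∞ :=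
  S.power Z h (S.serving Z ω) ω / (ENNReal.ofReal S.noise + S.interference Z h ω)

/-- Intensity measure of the path-loss process of the APs in state `v`: it maps `B` to
`∑ i, P (Z i is in state v and its path loss lies in B)`, which is the expected number of APs in
state `v` whose path loss lies in `B`. -/
noncomputable def pathLossIntensity [MeasurableSpace Ω] (Z : ℕ → Ω → Plane) (P : Measure Ω)
    (v : Visibility) : Measure ℝ :=
  Measure.sum fun i : ℕ =>
    (P.restrict {ω | S.visibility (Z i ω) = v}).map fun ω => S.pathLoss (Z i ω)

/-- `A_v(γ, x)`, the integral of `γ x / (y + γ x)` over `y > x` against the intensity measure of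
the path-loss process of the APs in state `v`. -/
noncomputable def interferenceExponent [MeasurableSpace Ω] (Z : ℕ → Ω → Plane) (P : Measure Ω)
    (v : Visibility) (γ x : ℝ) : ℝ≥0∞ :=
  ∫⁻ y in Ioi x, ENNReal.ofReal (γ * x / (y + γ * x)) ∂(S.pathLossIntensity Z P v)

end Sub6Network

/-! Write `y i` for the path loss of the `i`-th point and `X` for the least of them; mean powers are
inverse path losses, so `X` belongs to the serving point. For fixed positions, coverage means that
the serving gain exceeds `γ X (σ² + I)`, where `I` is the sum of `h i / y i` over the other points.
The exponential tail turns this probability into `exp (-γ σ² X)` times the Laplace transform of `I`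
at `γ X`, and each interfering gain contributes a factor `1 / (1 + γ X / y i)`. Hence the
conditional coverage probability given the positions is `exp (-γ σ² X - ∑ log (1 + γ X / y i))`
(`measure_lt_sinr_of_points`). Independence of fading and positions allows this to be integrated
over the positions (`measure_serving_inter_lt_sinr`).

The positions are then averaged given the serving point. Off the minimum they behave as a Poisson
process on levels above `X`, whose Laplace functional is `exp (-∫ (1 - exp (-f)) dΛ)`; for `f = log
(1 + γ X / y)` the integrand is exactly `γ X / (y + γ X)`.

Conditioning on the null event `X = x` is avoided by discretisation. Levels are rounded down to a
grid of mesh `1 / (n + 1)`. That the lowest occupied cell is `k`, with a single point, lying in `C`,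
is an event about counts in cells up to `k`; it is independent of the points in higher cells, so the
Laplace functional applies (`setLIntegral_expNeg_tsum_argmin`). As the mesh tends to zero the lowest
point is almost surely alone in its cell, and both sides converge
(`setLIntegral_expNeg_tsum_above`). Campbell's formula finally rewrites the integral against `Λ`
through the path-loss intensities.

Sums and integrals are kept in `[0, ∞]` with `exp (-∞) = 0`, so that divergent interference needs no
separate treatment. -/

open Filter Topology

/-! ### The exponential of a negative extended number -/

/-- The decreasing exponential `a ↦ exp (-a)` on `[0, ∞]`. -/
noncomputable def expNeg (a : ℝ≥0∞) : ℝ≥0∞ := EReal.exp (-(a : EReal))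

@[simp] lemma expNeg_zero : expNeg 0 = 1 := by simp [expNeg]

@[simp] lemma expNeg_top : expNeg ∞ = 0 := by simp [expNeg]

lemma expNeg_add (a b : ℝ≥0∞) : expNeg (a + b) = expNeg a * expNeg b := by
  unfold expNeg
  rw [← EReal.exp_add, EReal.coe_ennreal_add, EReal.neg_add, sub_eq_add_neg] <;> simp

lemma expNeg_ofReal {r : ℝ} (hr : 0 ≤ r) :
    expNeg (ENNReal.ofReal r) = ENNReal.ofReal (Real.exp (-r)) := by
  unfold expNeg
  rw [EReal.coe_ennreal_ofReal, max_eq_left hr, ← EReal.coe_neg, EReal.exp_coe]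

lemma antitone_expNeg : Antitone expNeg := fun _ _ h =>
  EReal.exp_monotone (EReal.neg_le_neg_iff.2 (EReal.coe_ennreal_le_coe_ennreal_iff.2 h))

lemma expNeg_le_one (a : ℝ≥0∞) : expNeg a ≤ 1 :=
  (antitone_expNeg bot_le).trans_eq expNeg_zero

lemma expNeg_ne_top (a : ℝ≥0∞) : expNeg a ≠ ∞ :=
  ((expNeg_le_one a).trans_lt ENNReal.one_lt_top).ne

lemma continuous_expNeg : Continuous expNeg :=
  ENNReal.continuous_exp.comp (continuous_neg.comp continuous_coe_ennreal_ereal)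

@[fun_prop]
lemma measurable_expNeg : Measurable expNeg := continuous_expNeg.measurable

lemma expNeg_sum {ι : Type*} (s : Finset ι) (a : ι → ℝ≥0∞) :
    expNeg (∑ i ∈ s, a i) = ∏ i ∈ s, expNeg (a i) := by
  classical
  induction s using Finset.induction_on with
  | empty => simp
  | insert i s hi ih => rw [Finset.sum_insert hi, Finset.prod_insert hi, expNeg_add, ih]

lemma expNeg_mul_natCast (c : ℝ≥0∞) (n : ℕ) : expNeg (c * n) = expNeg c ^ n := by
  induction n with
  | zero => simp
  | succ n ih => rw [Nat.cast_succ, mul_add, expNeg_add, ih, mul_one, pow_succ]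

lemma tendsto_lintegral_expNeg {α : Type*} [MeasurableSpace α] {μ : Measure α}
    [IsFiniteMeasure μ] {F : ℕ → α → ℝ≥0∞} {G : α → ℝ≥0∞} (hF : ∀ n, Measurable (F n))
    (h : ∀ a, Tendsto (fun n => F n a) atTop (𝓝 (G a))) :
    Tendsto (fun n => ∫⁻ a, expNeg (F n a) ∂μ) atTop (𝓝 (∫⁻ a, expNeg (G a) ∂μ)) := by
  refine tendsto_lintegral_of_dominated_convergence (fun _ => 1)
    (fun n => measurable_expNeg.comp (hF n)) (fun n => ae_of_all _ fun a => expNeg_le_one _)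
    (by simp) (ae_of_all _ fun a => (continuous_expNeg.tendsto _).comp (h a))

/-! ### The Poisson distribution -/

section Poisson

lemma lintegral_pow_poissonMeasure (r q : ℝ≥0) :
    ∫⁻ n, (q : ℝ≥0∞) ^ n ∂(poissonMeasure r) =
      ENNReal.ofReal (Real.exp (r * q - r)) := by
  rw [lintegral_countable']
  have h : ∀ n : ℕ, (q : ℝ≥0∞) ^ n * poissonMeasure r {n} =
      ENNReal.ofReal (Real.exp (-r) * ((r * q : ℝ) ^ n / n.factorial)) := fun n => by
    rw [poissonMeasure_singleton, ← ENNReal.ofReal_coe_nnreal, ← ENNReal.ofReal_pow q.coe_nonneg,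
      ← ENNReal.ofReal_mul (by positivity)]
    congr 1
    rw [mul_pow]; ring
  simp_rw [h]
  have hs : HasSum (fun n : ℕ => Real.exp (-r) * ((r * q : ℝ) ^ n / n.factorial))
      (Real.exp (-r) * Real.exp (r * q)) := by
    have := NormedSpace.expSeries_div_hasSum_exp (r * q : ℝ)
    rw [← Real.exp_eq_exp_ℝ] at this
    exact this.mul_left _
  rw [← ENNReal.ofReal_tsum_of_nonneg (fun n => by positivity) hs.summable, hs.tsum_eq,
    ← Real.exp_add]
  congr 2
  ring

/-- The generating function at `q = exp (-c)` is `exp (r q - r)`. The value `c = ∞` is allowed: then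
`q = 0` and the formula is the void probability. -/
lemma lintegral_expNeg_mul_poissonMeasure (r : ℝ≥0) (c : ℝ≥0∞) :
    ∫⁻ n, expNeg (c * n) ∂(poissonMeasure r) = expNeg ((1 - expNeg c) * r) := by
  simp_rw [expNeg_mul_natCast]
  lift expNeg c to ℝ≥0 using expNeg_ne_top c with q hq
  have hq1 : q ≤ 1 := by exact_mod_cast hq ▸ expNeg_le_one c
  rw [lintegral_pow_poissonMeasure]
  have : ((1 : ℝ≥0∞) - q) * r = ENNReal.ofReal ((1 - q) * r) := by
    rw [ENNReal.ofReal_mul (by simpa using hq1), ENNReal.ofReal_sub _ q.coe_nonneg]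
    simp
  rw [this, expNeg_ofReal (mul_nonneg (by simpa using hq1) r.coe_nonneg)]
  congr 2
  ring

/-- The term `n = 0` vanishes, and `(n + 1) p (n + 1) = r p n` reduces the rest to the total mass.
-/
lemma lintegral_natCast_poissonMeasure (r : ℝ≥0) :
    ∫⁻ n, (n : ℝ≥0∞) ∂(poissonMeasure r) = r := by
  rw [lintegral_countable', tsum_eq_zero_add' ENNReal.summable]
  have h : ∀ n : ℕ, ((n + 1 : ℕ) : ℝ≥0∞) * poissonMeasure r {n + 1} =
      r * poissonMeasure r {n} := fun n => by
    rw [poissonMeasure_singleton, poissonMeasure_singleton, ← ENNReal.ofReal_coe_nnreal,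
      ← ENNReal.ofReal_natCast, ← ENNReal.ofReal_mul (by positivity),
      ← ENNReal.ofReal_mul (by positivity)]
    congr 1
    rw [Nat.factorial_succ]
    push_cast
    field_simp
    ring
  simp_rw [h, ENNReal.tsum_mul_left]
  have : ∑' n, poissonMeasure r {n} = 1 := by
    rw [← measure_univ (μ := poissonMeasure r), ← lintegral_one, lintegral_countable']
    simp
  simp [this]

/-- From `exp (-r) ≥ 1 - r` follows `1 - (1 + r) exp (-r) ≤ r ^ 2`. The quadratic order is what
rules out ties between path losses. -/
lemma poissonMeasure_two_le (r : ℝ≥0) : poissonMeasure r {n | 2 ≤ n} ≤ (r : ℝ≥0∞) ^ 2 := by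
  have hc : {n : ℕ | 2 ≤ n} = ({0, 1} : Set ℕ)ᶜ := by
    ext n
    simp only [mem_ofPred_eq, mem_compl_iff, mem_insert_iff, mem_singleton_iff]
    omega
  have h01 : (poissonMeasure r).real {0, 1} = Real.exp (-r) + Real.exp (-r) * r := by
    rw [show ({0, 1} : Set ℕ) = {0} ∪ {1} from rfl, measureReal_union (by simp) (by simp),
      poissonMeasure_real_singleton, poissonMeasure_real_singleton]
    simp
  rw [hc, ← ENNReal.ofReal_toReal (measure_ne_top _ _), ← ENNReal.ofReal_coe_nnreal,
    ← ENNReal.ofReal_pow r.coe_nonneg]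
  refine ENNReal.ofReal_le_ofReal ?_
  rw [← measureReal_def, probReal_compl_eq_one_sub (by measurability), h01]
  nlinarith [Real.add_one_le_exp (-(r : ℝ)), r.coe_nonneg]

end Poisson

/-! ### Counting variables -/

section Counting

variable {Ω E : Type*}

lemma toENNReal_pointCount (Z : ℕ → Ω → E) (B : Set E) (ω : Ω) :
    (pointCount Z B ω : ℝ≥0∞) = ∑' i, B.indicator 1 (Z i ω) := by
  rw [pointCount, ← Measure.count_apply (MeasurableSet.of_discrete), ← lintegral_indicator_one
    MeasurableSet.of_discrete, lintegral_count]
  rfl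

lemma measurable_pointCount [MeasurableSpace Ω] [MeasurableSpace E] {Z : ℕ → Ω → E}
    (hZ : ∀ i, Measurable (Z i)) {B : Set E} (hB : MeasurableSet B) :
    Measurable (pointCount Z B) := by
  have h : Measurable fun ω => (pointCount Z B ω : ℝ≥0∞) := by
    simp_rw [toENNReal_pointCount]
    exact Measurable.tsum fun i => (measurable_one.indicator hB).comp (hZ i)
  refine measurable_to_countable' fun n => ?_
  have : pointCount Z B ⁻¹' {n} = (fun ω => (pointCount Z B ω : ℝ≥0∞)) ⁻¹' {(n : ℝ≥0∞)} := by
    ext ω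
    simp
  rw [this]
  exact h (measurableSet_singleton _)

/-- Sums of a simple function over the points are expressed through the counts. -/
lemma tsum_simpleFunc [MeasurableSpace E] (f : SimpleFunc E ℝ≥0∞) (Z : ℕ → Ω → E) (ω : Ω) :
    ∑' i, f (Z i ω) = ∑ c ∈ f.range, c * (pointCount Z (f ⁻¹' {c}) ω : ℝ≥0∞) := by
  have h : ∑' i, f (Z i ω) = ∫⁻ z, f z ∂(Measure.count.map fun i => Z i ω) := by
    rw [lintegral_map f.measurable measurable_from_nat, lintegral_count]
  rw [h, SimpleFunc.lintegral_eq_lintegral, SimpleFunc.lintegral]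
  refine Finset.sum_congr rfl fun c _ => ?_
  rw [Measure.map_apply measurable_from_nat (f.measurableSet_preimage _),
    Measure.count_apply MeasurableSet.of_discrete]
  rfl

end Counting

/-! ### Campbell's formula and the Laplace functional -/

namespace IsPoissonPointProcess

variable {Ω E : Type*} [MeasurableSpace Ω] [MeasurableSpace E] {Z : ℕ → Ω → E} {Λ : Measure E}
  {P : Measure Ω}

lemma map_pointCount [IsProbabilityMeasure P]
    (hZ : IsPoissonPointProcess Z Λ P) {B : Set E} (hB : MeasurableSet B)
    (hΛ : Λ B ≠ ∞) :
    P.map (pointCount Z B) = (poissonMeasure (Λ B).toNNReal).map Nat.cast := by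
  have hm := measurable_pointCount hZ.measurable_point hB
  have := Measure.isProbabilityMeasure_map hm.aemeasurable (μ := P)
  have hn : ∀ n : ℕ, P.map (pointCount Z B) {(n : ℕ∞)} =
      (poissonMeasure (Λ B).toNNReal).map Nat.cast {(n : ℕ∞)} := fun n => by
    rw [Measure.map_apply hm (measurableSet_singleton _),
      Measure.map_apply .of_discrete (measurableSet_singleton _)]
    refine (hZ.law_count B hB hΛ n).trans (congrArg _ ?_)
    ext m
    simp
  have hr : P.map (pointCount Z B) {⊤}ᶜ =
      (poissonMeasure (Λ B).toNNReal).map Nat.cast ({⊤}ᶜ : Set ℕ∞) := by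
    have : ({⊤}ᶜ : Set ℕ∞) = ⋃ n : ℕ, {(n : ℕ∞)} := by
      ext a
      induction a using ENat.recTopCoe <;> simp
    have hd : Pairwise (Function.onFun Disjoint fun n : ℕ => ({(n : ℕ∞)} : Set ℕ∞)) :=
      fun m n hmn => by simpa using hmn
    rw [this, measure_iUnion hd fun _ => measurableSet_singleton _,
      measure_iUnion hd fun _ => measurableSet_singleton _]
    exact tsum_congr hn
  -- The hypothesis prescribes the finite values only; the masses at `⊤` agree because both measures
  -- have total mass one.
  refine Measure.ext_of_singleton fun a => ?_
  induction a using ENat.recTopCoe with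
  | coe n => exact hn n
  | top =>
    rw [← compl_compl {(⊤ : ℕ∞)}, prob_compl_eq_one_sub (measurableSet_singleton _).compl,
      prob_compl_eq_one_sub (measurableSet_singleton _).compl, hr]

lemma lintegral_comp_pointCount [IsProbabilityMeasure P]
    (hZ : IsPoissonPointProcess Z Λ P) {B : Set E}
    (hB : MeasurableSet B) (hΛ : Λ B ≠ ∞) (φ : ℕ∞ → ℝ≥0∞) :
    ∫⁻ ω, φ (pointCount Z B ω) ∂P = ∫⁻ n, φ (n : ℕ) ∂(poissonMeasure (Λ B).toNNReal) := by
  rw [← lintegral_map (g := pointCount Z B) (f := φ) .of_discrete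
    (measurable_pointCount hZ.measurable_point hB), hZ.map_pointCount hB hΛ,
    lintegral_map .of_discrete .of_discrete]

lemma lintegral_pointCount [IsProbabilityMeasure P] (hZ : IsPoissonPointProcess Z Λ P) {B : Set E}
    (hB : MeasurableSet B) (hΛ : Λ B ≠ ∞) : ∫⁻ ω, (pointCount Z B ω : ℝ≥0∞) ∂P = Λ B := by
  rw [hZ.lintegral_comp_pointCount hB hΛ fun a => (a : ℝ≥0∞)]
  simp [lintegral_natCast_poissonMeasure, ENNReal.coe_toNNReal hΛ]

lemma ae_pointCount_ne_top [IsProbabilityMeasure P] (hZ : IsPoissonPointProcess Z Λ P) {B : Set E}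
    (hB : MeasurableSet B) (hΛ : Λ B ≠ ∞) : ∀ᵐ ω ∂P, pointCount Z B ω ≠ ⊤ := by
  have h := ae_lt_top (μ := P) (f := fun ω => (pointCount Z B ω : ℝ≥0∞))
    (Measurable.of_discrete.comp (measurable_pointCount hZ.measurable_point hB))
    (by rwa [hZ.lintegral_pointCount hB hΛ])
  filter_upwards [h] with ω hω
  simpa using hω.ne

lemma measure_two_le_pointCount [IsProbabilityMeasure P]
    (hZ : IsPoissonPointProcess Z Λ P) {B : Set E}
    (hB : MeasurableSet B) (hΛ : Λ B ≠ ∞) : P {ω | 2 ≤ pointCount Z B ω} ≤ Λ B ^ 2 := by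
  have h : P {ω | 2 ≤ pointCount Z B ω} = P.map (pointCount Z B) {a | 2 ≤ a} := by
    rw [Measure.map_apply (measurable_pointCount hZ.measurable_point hB) .of_discrete]
    rfl
  rw [h, hZ.map_pointCount hB hΛ, Measure.map_apply .of_discrete .of_discrete]
  refine (le_of_eq (congrArg _ ?_)).trans ((poissonMeasure_two_le _).trans_eq
    (by rw [ENNReal.coe_toNNReal hΛ]))
  ext n
  simp

lemma sum_map_apply [IsProbabilityMeasure P] (hZ : IsPoissonPointProcess Z Λ P) {B : Set E}
    (hB : MeasurableSet B) (hΛ : Λ B ≠ ∞) : (Measure.sum fun i => P.map (Z i)) B = Λ B := by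
  rw [← hZ.lintegral_pointCount hB hΛ, Measure.sum_apply _ hB]
  simp_rw [toENNReal_pointCount]
  rw [lintegral_tsum (f := fun i ω => B.indicator 1 (Z i ω)) fun i =>
    ((measurable_one.indicator hB).comp (hZ.measurable_point i)).aemeasurable]
  refine tsum_congr fun i => ?_
  rw [← lintegral_map (f := B.indicator 1) (measurable_one.indicator hB) (hZ.measurable_point i),
    lintegral_indicator_one hB]

/-- Campbell's formula: the law of the points sums to the intensity measure. -/
lemma sum_map_eq [IsProbabilityMeasure P] [SigmaFinite Λ] (hZ : IsPoissonPointProcess Z Λ P) :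
    (Measure.sum fun i => P.map (Z i)) = Λ := by
  ext B hB
  -- Counts are controlled only on sets of finite measure, hence the exhaustion by spanning sets.
  have hU : B = ⋃ n, B ∩ spanningSets Λ n := by
    rw [← inter_iUnion, iUnion_spanningSets, inter_univ]
  have hmono : Monotone fun n => B ∩ spanningSets Λ n := fun m n hmn =>
    inter_subset_inter_right _ (monotone_spanningSets Λ hmn)
  rw [hU, hmono.measure_iUnion, hmono.measure_iUnion]
  refine iSup_congr fun n => hZ.sum_map_apply
    (hB.inter (measurableSet_spanningSets Λ n)) ?_
  exact ((measure_mono inter_subset_right).trans_lt (measure_spanningSets_lt_top Λ n)).ne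

lemma lintegral_tsum_eq [IsProbabilityMeasure P] [SigmaFinite Λ]
    (hZ : IsPoissonPointProcess Z Λ P) {f : E → ℝ≥0∞}
    (hf : Measurable f) : ∑' i, ∫⁻ ω, f (Z i ω) ∂P = ∫⁻ z, f z ∂Λ := by
  conv_rhs => rw [← hZ.sum_map_eq]
  rw [lintegral_sum_measure]
  exact tsum_congr fun i => (lintegral_map hf (hZ.measurable_point i)).symm

lemma ae_forall_not_mem [IsProbabilityMeasure P]
    (hZ : IsPoissonPointProcess Z Λ P) {B : Set E} (hB : Λ B = 0) :
    ∀ᵐ ω ∂P, ∀ i, Z i ω ∉ B := by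
  obtain ⟨B', hBB', hB', h0⟩ := exists_measurable_superset_of_null hB
  have h := (hZ.sum_map_apply hB' (by simp [h0])).trans h0
  rw [Measure.sum_apply _ hB', ENNReal.tsum_eq_zero] at h
  refine ae_all_iff.2 fun i => ?_
  have hi := h i
  rw [Measure.map_apply (hZ.measurable_point i) hB'] at hi
  filter_upwards [measure_eq_zero_iff_ae_notMem.1 hi] with ω hω hb using hω (hBB' hb)

lemma iIndepFun_pointCount (hZ : IsPoissonPointProcess Z Λ P) {ι : Type*} [Fintype ι]
    (B : ι → Set E) (hB : ∀ j, MeasurableSet (B j)) (hΛ : ∀ j, Λ (B j) ≠ ∞)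
    (hd : Pairwise fun j l => Disjoint (B j) (B l)) :
    iIndepFun (fun j => pointCount Z (B j)) P := by
  let e := (Fintype.equivFin ι).symm
  have h := hZ.indep_count _ (fun j => B (e j)) (fun j => hB _) (fun j => hΛ _)
    (fun j l hjl => hd (e.injective.ne hjl))
  exact (iIndepFun_precomp_of_bijective (f := fun j => pointCount Z (B j)) e.bijective).1 h

variable [IsProbabilityMeasure P]

lemma lintegral_expNeg_mul_pointCount (hZ : IsPoissonPointProcess Z Λ P) {B : Set E}
    (hB : MeasurableSet B) (hΛ : Λ B ≠ ∞) (c : ℝ≥0∞) :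
    ∫⁻ ω, expNeg (c * (pointCount Z B ω : ℝ≥0∞)) ∂P = expNeg ((1 - expNeg c) * Λ B) := by
  rw [hZ.lintegral_comp_pointCount hB hΛ fun a => expNeg (c * (a : ℝ≥0∞))]
  simp [lintegral_expNeg_mul_poissonMeasure, ENNReal.coe_toNNReal hΛ]

/-- Laplace functional of a Poisson process at a simple function, on an event that concerns the
number of points in a disjoint set. -/
lemma lintegral_mul_expNeg_simpleFunc (hZ : IsPoissonPointProcess Z Λ P) {A : Set E}
    (hA : MeasurableSet A) (hΛA : Λ A ≠ ∞) (φ : ℕ∞ → ℝ≥0∞) (f : SimpleFunc E ℝ≥0∞)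
    (hfA : ∀ z ∈ A, f z = 0) (hf : ∀ c ≠ 0, Λ (f ⁻¹' {c}) ≠ ∞) :
    ∫⁻ ω, φ (pointCount Z A ω) * expNeg (∑' i, f (Z i ω)) ∂P =
      (∫⁻ ω, φ (pointCount Z A ω) ∂P) * expNeg (∫⁻ z, (1 - expNeg (f z)) ∂Λ) := by
  classical
  -- The value `0` contributes nothing and is dropped: its level set contains `A` and may have
  -- infinite measure. The other level sets together with `A`, indexed by `none`, form a disjoint
  -- family with independent counts.
  let s := f.range.erase 0
  have hs : ∀ c : s, (c : ℝ≥0∞) ≠ 0 := fun c => (Finset.mem_erase.1 c.2).1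
  let B : Option s → Set E := fun o => o.elim A fun c => f ⁻¹' {(c : ℝ≥0∞)}
  let ψ : Option s → ℕ∞ → ℝ≥0∞ := fun o a => o.elim (φ a) fun c => expNeg (c * (a : ℝ≥0∞))
  have hB : ∀ o, MeasurableSet (B o) := by
    rintro (_ | c)
    · exact hA
    · exact f.measurableSet_preimage _
  have hΛB : ∀ o, Λ (B o) ≠ ∞ := by
    rintro (_ | c)
    · exact hΛA
    · exact hf c (hs c)
  have hAc : ∀ c : s, Disjoint A (f ⁻¹' {(c : ℝ≥0∞)}) := fun c =>
    Set.disjoint_left.2 fun z hz hz' => hs c ((mem_singleton_iff.1 hz').symm.trans (hfA z hz))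
  have hd : Pairwise fun j l => Disjoint (B j) (B l) := by
    rintro (_ | c) (_ | c') h
    · exact (h rfl).elim
    · exact hAc c'
    · exact (hAc c).symm
    · refine Set.disjoint_left.2 fun z hz hz' => h ?_
      exact congrArg some (Subtype.ext ((mem_singleton_iff.1 hz).symm.trans hz'))
  have hi := (hZ.iIndepFun_pointCount B hB hΛB hd).comp ψ fun o => .of_discrete
  have hm : ∀ o, Measurable (ψ o ∘ pointCount Z (B o)) := fun o =>
    Measurable.of_discrete.comp (measurable_pointCount hZ.measurable_point (hB o))
  have key := lintegral_prod_eq_prod_lintegral_of_indepFun Finset.univ _ hi hm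
  simp only [Fintype.prod_option] at key
  have h0 : ∀ g : ℝ≥0∞ → ℝ≥0∞, g 0 = 0 → ∑ c ∈ f.range, g c = ∑ c : s, g c := fun g hg => by
    rw [Finset.sum_coe_sort s g]
    exact (Finset.sum_erase _ hg).symm
  have hL : ∀ ω, expNeg (∑' i, f (Z i ω)) =
      ∏ c : s, (ψ (some c) ∘ pointCount Z (B (some c))) ω := fun ω => by
    rw [tsum_simpleFunc, h0 (fun c => c * (pointCount Z (f ⁻¹' {c}) ω : ℝ≥0∞)) (by simp),
      expNeg_sum]
    rfl
  have hR : expNeg (∫⁻ z, (1 - expNeg (f z)) ∂Λ) =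
      ∏ c : s, ∫⁻ ω, (ψ (some c) ∘ pointCount Z (B (some c))) ω ∂P := by
    have : ∫⁻ z, (1 - expNeg (f z)) ∂Λ = ∑ c ∈ f.range, (1 - expNeg c) * Λ (f ⁻¹' {c}) := by
      rw [← SimpleFunc.map_lintegral, ← SimpleFunc.lintegral_eq_lintegral]
      rfl
    rw [this, h0 (fun c => (1 - expNeg c) * Λ (f ⁻¹' {c})) (by simp), expNeg_sum]
    exact Finset.prod_congr rfl fun c _ => (hZ.lintegral_expNeg_mul_pointCount
      (hB (some c)) (hΛB (some c)) c).symm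
  simp_rw [hL, hR]
  exact key

/-- Laplace functional of a Poisson process, on an event that concerns the number of points in
a set where the test function vanishes. -/
theorem lintegral_mul_expNeg_tsum [SigmaFinite Λ] (hZ : IsPoissonPointProcess Z Λ P) {A : Set E}
    (hA : MeasurableSet A) (hΛA : Λ A ≠ ∞) (φ : ℕ∞ → ℝ≥0∞) (hφ : ∀ a, φ a ≤ 1)
    {f : E → ℝ≥0∞} (hfm : Measurable f) (hfA : ∀ z ∈ A, f z = 0) :
    ∫⁻ ω, φ (pointCount Z A ω) * expNeg (∑' i, f (Z i ω)) ∂P =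
      (∫⁻ ω, φ (pointCount Z A ω) ∂P) * expNeg (∫⁻ z, (1 - expNeg (f z)) ∂Λ) := by
  -- Cutting off to the spanning sets makes every nonzero level set of finite measure while keeping
  -- the sequence increasing to `f`.
  let F : ℕ → SimpleFunc E ℝ≥0∞ := fun n => (SimpleFunc.eapprox f n).restrict (spanningSets Λ n)
  have hFa : ∀ n z, F n z = (spanningSets Λ n).indicator (SimpleFunc.eapprox f n) z := fun n z =>
    SimpleFunc.restrict_apply _ (measurableSet_spanningSets Λ n) z
  have hmono : Monotone F := fun m n hmn z => by
    rw [hFa, hFa]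
    exact (indicator_le_indicator_of_subset (monotone_spanningSets Λ hmn) (fun _ => bot_le) z).trans
      (indicator_le_indicator (SimpleFunc.monotone_eapprox f hmn z))
  have hle : ∀ n z, F n z ≤ f z := fun n z => by
    rw [hFa]
    refine (indicator_le_self _ _ z).trans ?_
    rw [← SimpleFunc.iSup_eapprox_apply hfm z]
    exact le_iSup (fun n => SimpleFunc.eapprox f n z) n
  have hlim : ∀ z, Tendsto (fun n => F n z) atTop (𝓝 (f z)) := fun z => by
    have h1 : Tendsto (fun n => SimpleFunc.eapprox f n z) atTop (𝓝 (f z)) := by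
      rw [← SimpleFunc.iSup_eapprox_apply hfm z]
      exact tendsto_atTop_iSup fun m n hmn => SimpleFunc.monotone_eapprox f hmn z
    refine h1.congr' ?_
    filter_upwards [eventually_mem_spanningSets Λ z] with n hn
    rw [hFa, indicator_of_mem hn]
  have hsum : ∀ ω, Tendsto (fun n => ∑' i, F n (Z i ω)) atTop (𝓝 (∑' i, f (Z i ω))) := fun ω => by
    simp_rw [← lintegral_count]
    exact lintegral_tendsto_of_tendsto_of_monotone (fun n => Measurable.of_discrete.aemeasurable)
      (ae_of_all _ fun i m n hmn => hmono hmn _) (ae_of_all _ fun i => hlim _)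
  have hint : Tendsto (fun n => ∫⁻ z, (1 - expNeg (F n z)) ∂Λ) atTop
      (𝓝 (∫⁻ z, (1 - expNeg (f z)) ∂Λ)) := by
    refine lintegral_tendsto_of_tendsto_of_monotone
      (fun n => (measurable_const.sub (measurable_expNeg.comp (F n).measurable)).aemeasurable)
      (ae_of_all _ fun z m n hmn => tsub_le_tsub_left (antitone_expNeg (hmono hmn z)) _)
      (ae_of_all _ fun z => ?_)
    exact ENNReal.Tendsto.sub tendsto_const_nhds ((continuous_expNeg.tendsto _).comp (hlim z))
      (Or.inl ENNReal.one_ne_top)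
  have hmA : Measurable fun ω => φ (pointCount Z A ω) :=
    Measurable.of_discrete.comp (measurable_pointCount hZ.measurable_point hA)
  have hφi : ∫⁻ ω, φ (pointCount Z A ω) ∂P ≤ 1 :=
    (lintegral_mono fun ω => hφ _).trans_eq (by simp)
  have key : ∀ n, ∫⁻ ω, φ (pointCount Z A ω) * expNeg (∑' i, F n (Z i ω)) ∂P =
      (∫⁻ ω, φ (pointCount Z A ω) ∂P) * expNeg (∫⁻ z, (1 - expNeg (F n z)) ∂Λ) := fun n => by
    refine hZ.lintegral_mul_expNeg_simpleFunc hA hΛA φ (F n)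
      (fun z hz => le_antisymm ((hle n z).trans_eq (hfA z hz)) bot_le) fun c hc => ?_
    refine ((measure_mono fun z hz => ?_).trans_lt (measure_spanningSets_lt_top Λ n)).ne
    by_contra hz'
    refine hc ?_
    rw [← mem_singleton_iff.1 hz, hFa, indicator_of_notMem hz']
  refine tendsto_nhds_unique ?_ ((ENNReal.Tendsto.const_mul
    ((continuous_expNeg.tendsto _).comp hint)
    (Or.inr (hφi.trans_lt ENNReal.one_lt_top).ne)).congr fun n => (key n).symm)
  refine tendsto_lintegral_of_dominated_convergence (fun _ => 1) (fun n => hmA.mul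
    (measurable_expNeg.comp (Measurable.tsum fun i =>
      (F n).measurable.comp (hZ.measurable_point i))))
    (fun n => ae_of_all _ fun ω => mul_le_one' (hφ _) (expNeg_le_one _)) (by simp)
    (ae_of_all _ fun ω => ?_)
  exact ENNReal.Tendsto.const_mul ((continuous_expNeg.tendsto _).comp (hsum ω))
    (Or.inr ((hφ _).trans_lt ENNReal.one_lt_top).ne)

end IsPoissonPointProcess

lemma pointCount_eq_zero_iff {Ω E : Type*} {Z : ℕ → Ω → E} {B : Set E} {ω : Ω} :
    pointCount Z B ω = 0 ↔ ∀ i, Z i ω ∉ B := by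
  rw [pointCount, encard_eq_zero, eq_empty_iff_forall_notMem]
  rfl

/-! ### Interference kernels and their dependence on the serving path loss -/

section Perturbation

/-- Convergence of truncated integrals `∫_{s ≥ τ} φ(τ, s) dμ` as `τ` decreases to `x`, for kernels
that grow at most linearly in the first variable. -/
lemma tendsto_lintegral_truncated {T : Type*} [MeasurableSpace T] {μ : Measure T} {s : T → ℝ}
    (hs : Measurable s) {φ : ℝ → ℝ → ℝ≥0∞} (hφ : ∀ t, Measurable (φ t)) {x : ℝ} (hx : 0 < x)
    (hcont : ∀ y, x < y → ContinuousAt (fun t => φ t y) x)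
    (hle : ∀ t y, x ≤ t → x < y → φ t y ≤ ENNReal.ofReal (t / x) * φ x y)
    {τ : ℕ → ℝ} (hτx : ∀ n, x < τ n) (hτ : Tendsto τ atTop (𝓝 x)) :
    Tendsto (fun n => ∫⁻ a, {a | τ n ≤ s a}.indicator (fun a => φ (τ n) (s a)) a ∂μ) atTop
      (𝓝 (∫⁻ a, {a | x < s a}.indicator (fun a => φ x (s a)) a ∂μ)) := by
  have hm : ∀ n, Measurable ({a | τ n ≤ s a}.indicator fun a => φ (τ n) (s a)) := fun n =>
    ((hφ _).comp hs).indicator (measurableSet_le measurable_const hs)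
  have hlim : ∀ a, Tendsto (fun n => {a | τ n ≤ s a}.indicator (fun a => φ (τ n) (s a)) a) atTop
      (𝓝 ({a | x < s a}.indicator (fun a => φ x (s a)) a)) := fun a => by
    by_cases ha : x < s a
    · rw [indicator_of_mem (show a ∈ {a | x < s a} from ha)]
      refine ((hcont _ ha).tendsto.comp hτ).congr' ?_
      filter_upwards [hτ.eventually_lt_const ha] with n hn
      rw [indicator_of_mem (show a ∈ {a | τ n ≤ s a} from hn.le)]
      rfl
    · rw [indicator_of_notMem (show a ∉ {a | x < s a} from ha)]
      refine tendsto_const_nhds.congr fun n => ?_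
      rw [indicator_of_notMem (show a ∉ {a | τ n ≤ s a} from
        fun h => ha ((hτx n).trans_le h))]
  -- Fatou's lemma gives the lower bound, and the factor `τ n / x → 1` the upper one. No integrable
  -- majorant is needed, so an infinite limit is covered.
  refine tendsto_of_le_liminf_of_limsup_le ?_ ?_
  · refine le_trans (le_of_eq ?_) (lintegral_liminf_le hm)
    exact lintegral_congr fun a => (hlim a).liminf_eq.symm
  · have hub : ∀ n, ∫⁻ a, {a | τ n ≤ s a}.indicator (fun a => φ (τ n) (s a)) a ∂μ ≤
        ENNReal.ofReal (τ n / x) * ∫⁻ a, {a | x < s a}.indicator (fun a => φ x (s a)) a ∂μ :=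
      fun n => by
        rw [← lintegral_const_mul' _ _ ENNReal.ofReal_ne_top]
        refine lintegral_mono fun a => ?_
        by_cases ha : τ n ≤ s a
        · rw [indicator_of_mem (show a ∈ {a | τ n ≤ s a} from ha),
            indicator_of_mem (show a ∈ {a | x < s a} from (hτx n).trans_le ha)]
          exact hle _ _ (hτx n).le ((hτx n).trans_le ha)
        · rw [indicator_of_notMem (show a ∉ {a | τ n ≤ s a} from ha)]
          exact bot_le
    have h1 : Tendsto (fun n => ENNReal.ofReal (τ n / x)) atTop (𝓝 1) := by
      have := ENNReal.tendsto_ofReal (hτ.div_const x)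
      rwa [div_self hx.ne', ENNReal.ofReal_one] at this
    have h2 := ENNReal.Tendsto.mul_const (b := ∫⁻ a, {a | x < s a}.indicator
      (fun a => φ x (s a)) a ∂μ) h1 (Or.inl one_ne_zero)
    rw [one_mul] at h2
    exact (limsup_le_limsup (Eventually.of_forall hub)).trans_eq h2.limsup_eq

/-- Exponent of the Laplace transform of an exponential variable scaled by `γ t / y`. -/
noncomputable def logKernel (γ t y : ℝ) : ℝ≥0∞ := ENNReal.ofReal (Real.log (1 + γ * t / y))

/-- The kernel `γ t / (y + γ t)` of the interference exponent. -/
noncomputable def ratioKernel (γ t y : ℝ) : ℝ≥0∞ := ENNReal.ofReal (γ * t / (y + γ * t))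

lemma measurable_logKernel (γ : ℝ) : Measurable fun p : ℝ × ℝ => logKernel γ p.1 p.2 := by
  unfold logKernel
  fun_prop

lemma measurable_ratioKernel (γ : ℝ) : Measurable fun p : ℝ × ℝ => ratioKernel γ p.1 p.2 := by
  unfold ratioKernel
  fun_prop

lemma expNeg_logKernel {γ t y : ℝ} (hγ : 0 < γ) (ht : 0 ≤ t) (hy : 0 < y) :
    expNeg (logKernel γ t y) = ENNReal.ofReal (1 / (1 + γ * t / y)) := by
  have h0 : 0 ≤ γ * t / y := by positivity
  rw [logKernel, expNeg_ofReal (Real.log_nonneg (by linarith)), Real.exp_neg,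
    Real.exp_log (by linarith), one_div]

/-- This identity carries the fading exponent, through the Laplace functional, to the kernel of the
interference exponent. -/
lemma one_sub_expNeg_logKernel {γ t y : ℝ} (hγ : 0 < γ) (ht : 0 ≤ t) (hy : 0 < y) :
    1 - expNeg (logKernel γ t y) = ratioKernel γ t y := by
  have h0 : 0 ≤ γ * t := by positivity
  have h1 : 0 < y + γ * t := by linarith
  rw [expNeg_logKernel hγ ht hy, ratioKernel, ← ENNReal.ofReal_one,
    ← ENNReal.ofReal_sub _ (by positivity)]
  congr 1
  field_simp
  ring

/-- Bernoulli's inequality `1 + p s ≤ (1 + s) ^ p` with `s = γ x / y` and `p = t / x ≥ 1`, after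
taking logarithms. -/
lemma logKernel_le {γ x t y : ℝ} (hγ : 0 < γ) (hx : 0 < x) (hxt : x ≤ t) (hy : 0 < y) :
    logKernel γ t y ≤ ENNReal.ofReal (t / x) * logKernel γ x y := by
  have ht : 0 < t := hx.trans_le hxt
  have h0 : 0 < γ * x / y := by positivity
  rw [logKernel, logKernel, ← ENNReal.ofReal_mul (by positivity)]
  refine ENNReal.ofReal_le_ofReal ?_
  rw [← Real.log_rpow (by linarith)]
  refine Real.log_le_log (by positivity) ?_
  have := one_add_mul_self_le_rpow_one_add (s := γ * x / y) (by linarith) (p := t / x)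
    ((one_le_div hx).2 hxt)
  refine le_trans (le_of_eq ?_) this
  field_simp

lemma ratioKernel_le {γ x t y : ℝ} (hγ : 0 < γ) (hx : 0 < x) (hxt : x ≤ t) (hy : 0 < y) :
    ratioKernel γ t y ≤ ENNReal.ofReal (t / x) * ratioKernel γ x y := by
  have ht : 0 < t := hx.trans_le hxt
  rw [ratioKernel, ratioKernel, ← ENNReal.ofReal_mul (by positivity)]
  refine ENNReal.ofReal_le_ofReal ?_
  have : t / x * (γ * x / (y + γ * x)) = γ * t / (y + γ * x) := by field_simp
  rw [this]
  gcongr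

lemma continuousAt_logKernel {γ x y : ℝ} (hγ : 0 < γ) (hx : 0 < x) (hy : 0 < y) :
    ContinuousAt (fun t => logKernel γ t y) x := by
  unfold logKernel
  refine ENNReal.continuous_ofReal.continuousAt.comp (ContinuousAt.log (by fun_prop) ?_)
  positivity

lemma continuousAt_ratioKernel {γ x y : ℝ} (hγ : 0 < γ) (hx : 0 < x) (hy : 0 < y) :
    ContinuousAt (fun t => ratioKernel γ t y) x := by
  unfold ratioKernel
  refine ENNReal.continuous_ofReal.continuousAt.comp (ContinuousAt.div (by fun_prop)
    (by fun_prop) ?_)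
  positivity

end Perturbation

/-! ### Conditioning on a discretised minimum, and uniqueness of the minimum -/

namespace IsPoissonPointProcess

variable {Ω E : Type*} [MeasurableSpace Ω] [MeasurableSpace E] {Z : ℕ → Ω → E} {Λ : Measure E}
  {P : Measure Ω} [IsProbabilityMeasure P]

/-- Points in `A ∪ A'` do not enter the sum, so the event about them is independent of it. -/
lemma setLIntegral_expNeg_tsum [SigmaFinite Λ] (hZ : IsPoissonPointProcess Z Λ P) {A A' : Set E}
    (hA : MeasurableSet A) (hΛA : Λ A ≠ ∞) (hA' : MeasurableSet A') (hAA' : Disjoint A A')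
    {f : E → ℝ≥0∞} (hfm : Measurable f) (hfA : ∀ z ∈ A, f z = 0) (hfA' : ∀ z ∈ A', f z = 0) :
    ∫⁻ ω in {ω | pointCount Z A ω = 1 ∧ pointCount Z A' ω = 0}, expNeg (∑' i, f (Z i ω)) ∂P =
      P {ω | pointCount Z A ω = 1 ∧ pointCount Z A' ω = 0} *
        expNeg (∫⁻ z, (1 - expNeg (f z)) ∂Λ) := by
  classical
  let φ : ℕ∞ → ℝ≥0∞ := fun a => if a = 1 then 1 else 0
  have hφ : ∀ a, φ a ≤ 1 := fun a => by
    by_cases h : a = 1 <;> simp [φ, h]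
  have hD : MeasurableSet {ω | pointCount Z A ω = 1 ∧ pointCount Z A' ω = 0} :=
    (measurable_pointCount hZ.measurable_point hA (measurableSet_singleton 1)).inter
      (measurable_pointCount hZ.measurable_point hA' (measurableSet_singleton 0))
  have key : ∀ g : E → ℝ≥0∞, Measurable g → (∀ z ∈ A, g z = 0) → (∀ z ∈ A', g z = 0) →
      ∫⁻ ω in {ω | pointCount Z A ω = 1 ∧ pointCount Z A' ω = 0}, expNeg (∑' i, g (Z i ω)) ∂P =
      (∫⁻ ω, φ (pointCount Z A ω) ∂P) * expNeg (Λ A') *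
        expNeg (∫⁻ z, (1 - expNeg (g z)) ∂Λ) := by
    intro g hg hgA hgA'
    -- The void event on `A'` is encoded by the weight `∞`: the factor `exp (-∞ · N)` is its
    -- indicator. Thus `A'` may have infinite measure.
    have hm : Measurable fun z => A'.indicator (fun _ => ∞) z + g z :=
      (measurable_const.indicator hA').add hg
    have h := hZ.lintegral_mul_expNeg_tsum hA hΛA φ hφ hm fun z hz => by
      rw [indicator_of_notMem (Set.disjoint_left.1 hAA' hz), hgA z hz, add_zero]
    have hR : ∫⁻ z, (1 - expNeg (A'.indicator (fun _ => ∞) z + g z)) ∂Λ =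
        Λ A' + ∫⁻ z, (1 - expNeg (g z)) ∂Λ := by
      rw [← lintegral_indicator_one hA', ← lintegral_add_left (measurable_one.indicator hA')]
      refine lintegral_congr fun z => ?_
      by_cases hz : z ∈ A'
      · simp [hz, hgA' z hz]
      · simp [hz]
    rw [hR, expNeg_add, ← mul_assoc] at h
    rw [← h, ← lintegral_indicator hD]
    refine lintegral_congr fun ω => ?_
    rw [ENNReal.tsum_add, expNeg_add]
    by_cases h1 : pointCount Z A ω = 1
    · by_cases h0 : pointCount Z A' ω = 0
      · rw [indicator_of_mem (by exact ⟨h1, h0⟩)]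
        have : ∀ i, A'.indicator (fun _ => (∞ : ℝ≥0∞)) (Z i ω) = 0 := fun i =>
          indicator_of_notMem (pointCount_eq_zero_iff.1 h0 i) _
        simp [φ, h1, this]
      · rw [indicator_of_notMem fun hω => h0 hω.2]
        obtain ⟨i, hi⟩ : ∃ i, Z i ω ∈ A' := by
          by_contra! hc
          exact h0 (pointCount_eq_zero_iff.2 hc)
        have : ∑' i, A'.indicator (fun _ => (∞ : ℝ≥0∞)) (Z i ω) = ∞ :=
          ENNReal.tsum_eq_top_of_eq_top ⟨i, indicator_of_mem hi _⟩
        simp [this]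
    · rw [indicator_of_notMem fun hω => h1 hω.1]
      simp [φ, h1]
  -- The case of the zero function identifies the prefactor as the probability of the event.
  have h0 := key (fun _ => 0) measurable_const (fun _ _ => rfl) fun _ _ => rfl
  simp only [tsum_zero, expNeg_zero, tsub_self, lintegral_zero, mul_one,
    setLIntegral_one] at h0
  rw [key f hfm hfA hfA', h0]

/-- Conditioning on the minimal value of an integer-valued function `c` of the points: given that
it is attained only once, at a point of `C`, the other points are those of a Poisson process above
that value. -/
lemma setLIntegral_expNeg_tsum_argmin [SigmaFinite Λ] (hZ : IsPoissonPointProcess Z Λ P)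
    {c : E → ℕ} (hc : Measurable c) (hΛ : ∀ k, Λ {z | c z = k} ≠ ∞) {κ : Ω → ℕ}
    (hκ : ∀ᵐ ω ∂P, ∀ j, c (Z (κ ω) ω) ≤ c (Z j ω)) {C : Set E} (hC : MeasurableSet C)
    {f : ℕ → E → ℝ≥0∞} (hf : ∀ k, Measurable (f k)) (hf0 : ∀ k z, c z ≤ k → f k z = 0) :
    ∫⁻ ω in {ω | Z (κ ω) ω ∈ C ∧ ∀ j, j ≠ κ ω → c (Z (κ ω) ω) < c (Z j ω)},
        expNeg (∑' i, f (c (Z (κ ω) ω)) (Z i ω)) ∂P =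
      ∫⁻ ω in {ω | Z (κ ω) ω ∈ C ∧ ∀ j, j ≠ κ ω → c (Z (κ ω) ω) < c (Z j ω)},
        expNeg (∫⁻ z, (1 - expNeg (f (c (Z (κ ω) ω)) z)) ∂Λ) ∂P := by
  let A : ℕ → Set E := fun k => {z | c z = k} ∩ C
  -- Cell `k` outside `C` is also forbidden, so that the only point of the cell has to lie in `C`.
  let A' : ℕ → Set E := fun k => {z | c z < k} ∪ ({z | c z = k} \ C)
  have hck : ∀ k, MeasurableSet {z | c z = k} := fun k => hc (measurableSet_singleton k)
  have hA : ∀ k, MeasurableSet (A k) := fun k => (hck k).inter hC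
  have hA' : ∀ k, MeasurableSet (A' k) := fun k =>
    (measurableSet_lt hc measurable_const).union ((hck k).diff hC)
  have hAA' : ∀ k, Disjoint (A k) (A' k) := fun k => Set.disjoint_left.2 fun z hz hz' =>
    hz'.elim (fun h => (show c z < k from h).ne hz.1) fun h => h.2 hz.2
  let D : ℕ → Set Ω := fun k => {ω | pointCount Z (A k) ω = 1 ∧ pointCount Z (A' k) ω = 0}
  have hD : ∀ k, MeasurableSet (D k) := fun k =>
    (measurable_pointCount hZ.measurable_point (hA k) (measurableSet_singleton 1)).inter
      (measurable_pointCount hZ.measurable_point (hA' k) (measurableSet_singleton 0))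
  have hiff : ∀ᵐ ω ∂P, ∀ k, ω ∈ D k ↔
      (Z (κ ω) ω ∈ C ∧ ∀ j, j ≠ κ ω → c (Z (κ ω) ω) < c (Z j ω)) ∧ c (Z (κ ω) ω) = k := by
    filter_upwards [hκ] with ω hω k
    constructor
    · rintro ⟨h1, h0⟩
      rw [pointCount_eq_zero_iff] at h0
      obtain ⟨i, hi⟩ := encard_eq_one.1 h1
      have hmem : ∀ j, Z j ω ∈ A k ↔ j = i := fun j => by
        rw [← mem_singleton_iff, ← hi]
        rfl
      have hki : c (Z i ω) = k := ((hmem i).2 rfl).1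
      have hge : ∀ j, k ≤ c (Z j ω) := fun j => not_lt.1 fun h => h0 j (Or.inl h)
      have hkk : c (Z (κ ω) ω) = k := le_antisymm ((hω i).trans_eq hki) (hge _)
      have hCm : ∀ j, c (Z j ω) = k → Z j ω ∈ C := fun j hj => by
        by_contra hjC
        exact h0 j (Or.inr ⟨hj, hjC⟩)
      have heq : ∀ j, c (Z j ω) = k → j = i := fun j hj => (hmem j).1 ⟨hj, hCm j hj⟩
      refine ⟨⟨hCm _ hkk, fun j hj => ?_⟩, hkk⟩
      refine lt_of_le_of_ne (hω j) fun h => hj ?_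
      rw [heq j (h.symm.trans hkk), heq _ hkk]
    · rintro ⟨⟨hκC, hlt⟩, rfl⟩
      refine ⟨encard_eq_one.2 ⟨κ ω, ?_⟩, pointCount_eq_zero_iff.2 fun j hj => ?_⟩
      · ext j
        refine ⟨fun hj => ?_, fun hj => ?_⟩
        · by_contra hne
          exact (hlt j hne).ne' hj.1
        · rw [mem_singleton_iff.1 hj]
          exact ⟨rfl, hκC⟩
      · rcases hj with h | h
        · exact (hω j).not_gt h
        · by_cases hne : j = κ ω
          · exact h.2 (hne ▸ hκC)
          · exact (hlt j hne).ne' h.1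
  have hU : {ω | Z (κ ω) ω ∈ C ∧ ∀ j, j ≠ κ ω → c (Z (κ ω) ω) < c (Z j ω)} =ᵐ[P]
      (⋃ k, D k : Set Ω) := by
    filter_upwards [hiff] with ω hω
    refine propext ⟨fun h => ?_, fun h => ?_⟩
    · exact mem_iUnion.2 ⟨_, (hω _).2 ⟨h, rfl⟩⟩
    · obtain ⟨k, hk⟩ := mem_iUnion.1 h
      exact ((hω k).1 hk).1
  have hdisj : Pairwise (Function.onFun (AEDisjoint P) D) := fun k l hkl => by
    refine measure_eq_zero_iff_ae_notMem.2 ?_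
    filter_upwards [hiff] with ω hω h
    exact hkl (((hω k).1 h.1).2.symm.trans ((hω l).1 h.2).2)
  rw [setLIntegral_congr hU, setLIntegral_congr hU,
    lintegral_iUnion₀ (fun k => (hD k).nullMeasurableSet) hdisj,
    lintegral_iUnion₀ (fun k => (hD k).nullMeasurableSet) hdisj]
  refine tsum_congr fun k => ?_
  have h1 : ∫⁻ ω in D k, expNeg (∑' i, f (c (Z (κ ω) ω)) (Z i ω)) ∂P =
      ∫⁻ ω in D k, expNeg (∑' i, f k (Z i ω)) ∂P := by
    refine setLIntegral_congr_fun_ae (hD k) ?_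
    filter_upwards [hiff] with ω hω h
    rw [((hω k).1 h).2]
  have h2 : ∫⁻ ω in D k, expNeg (∫⁻ z, (1 - expNeg (f (c (Z (κ ω) ω)) z)) ∂Λ) ∂P =
      ∫⁻ ω in D k, expNeg (∫⁻ z, (1 - expNeg (f k z)) ∂Λ) ∂P := by
    refine setLIntegral_congr_fun_ae (hD k) ?_
    filter_upwards [hiff] with ω hω h
    rw [((hω k).1 h).2]
  rw [h1, h2, setLIntegral_const, mul_comm]
  refine hZ.setLIntegral_expNeg_tsum (hA k)
    ((measure_mono inter_subset_left).trans_lt (hΛ k).lt_top).ne (hA' k) (hAA' k) (hf k)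
    (fun z hz => hf0 k z hz.1.le) fun z hz => hf0 k z ?_
  rcases hz with h | h
  · exact (show c z < k from h).le
  · exact (show c z = k from h.1).le

section Level

variable {y : E → ℝ}

lemma ae_finite_le (hZ : IsPoissonPointProcess Z Λ P) (hy : Measurable y)
    (hfin : ∀ t, Λ {z | y z ≤ t} ≠ ∞) : ∀ᵐ ω ∂P, ∀ t, {i | y (Z i ω) ≤ t}.Finite := by
  have h := ae_all_iff.2 fun n : ℕ => hZ.ae_pointCount_ne_top (B := {z | y z ≤ n})
    (measurableSet_le hy measurable_const) (hfin n)
  filter_upwards [h] with ω hω t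
  obtain ⟨n, hn⟩ := exists_nat_ge t
  exact (encard_ne_top_iff.1 (hω n)).subset fun i hi => (show y (Z i ω) ≤ t from hi).trans hn

/-- Almost surely, no two points of the process have the same level. -/
lemma ae_ne_of_ne (hZ : IsPoissonPointProcess Z Λ P) (hy : Measurable y) (hy0 : ∀ z, 0 ≤ y z)
    (hfin : ∀ t, Λ {z | y z ≤ t} ≠ ∞) (hnull : ∀ t, Λ {z | y z = t} = 0) :
    ∀ᵐ ω ∂P, ∀ i j, i ≠ j → y (Z i ω) ≠ y (Z j ω) := by
  -- Points with a common level at most `M` share a band of width `1 / (n + 1)`. The second-order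
  -- Poisson bound sums over the bands to at most the `ν × ν` measure of a strip around the set of
  -- equal levels, and that set is null because single levels are.
  have key : ∀ M : ℕ, P {ω | ∃ i j, i ≠ j ∧ y (Z i ω) = y (Z j ω) ∧ y (Z i ω) ≤ M} = 0 := by
    intro M
    let ν := Λ.restrict {z | y z ≤ M}
    have hM : MeasurableSet {z | y z ≤ M} := measurableSet_le hy measurable_const
    have : IsFiniteMeasure ν := ⟨by simpa [ν] using (hfin M).lt_top⟩
    let T : ℕ → Set (E × E) := fun n => {p | |y p.1 - y p.2| ≤ 1 / ((n : ℝ) + 1)}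
    have hT : ∀ n, MeasurableSet (T n) := fun n =>
      measurableSet_le (by fun_prop) measurable_const
    have hanti : Antitone T := fun m n hmn p hp =>
      (show |y p.1 - y p.2| ≤ 1 / ((n : ℝ) + 1) from hp).trans (by
        show 1 / ((n : ℝ) + 1) ≤ 1 / ((m : ℝ) + 1)
        gcongr)
    have hlim : Tendsto (fun n => (ν.prod ν) (T n)) atTop (𝓝 0) := by
      have h := tendsto_measure_iInter_atTop (μ := ν.prod ν)
        (fun n => (hT n).nullMeasurableSet) hanti ⟨0, measure_ne_top _ _⟩
      have hI : ⋂ n, T n = {p | y p.1 = y p.2} := by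
        ext p
        rw [mem_iInter]
        refine ⟨fun hp => ?_, fun hp n => ?_⟩
        · have : |y p.1 - y p.2| ≤ 0 :=
            ge_of_tendsto' tendsto_one_div_add_atTop_nhds_zero_nat fun n => hp n
          exact sub_eq_zero.1 (abs_eq_zero.1 (le_antisymm this (abs_nonneg _)))
        · show |y p.1 - y p.2| ≤ 1 / ((n : ℝ) + 1)
          rw [show y p.1 = y p.2 from hp, sub_self, abs_zero]
          positivity
      have hI0 : (ν.prod ν) {p | y p.1 = y p.2} = 0 := by
        rw [Measure.measure_prod_null (measurableSet_eq_fun (by fun_prop) (by fun_prop))]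
        refine ae_of_all _ fun z => ?_
        refine le_antisymm ((Measure.restrict_apply_le _ _).trans ?_) bot_le
        exact le_of_eq ((congrArg Λ (by ext w; exact eq_comm)).trans (hnull (y z)))
      rwa [hI, hI0] at h
    refine le_antisymm (ge_of_tendsto' hlim fun n => ?_) bot_le
    let B : ℕ → Set E := fun k => {z | y z ≤ M} ∩ {z | ⌊((n : ℝ) + 1) * y z⌋₊ = k}
    have hfl : Measurable fun z => ⌊((n : ℝ) + 1) * y z⌋₊ := by fun_prop
    have hB : ∀ k, MeasurableSet (B k) := fun k =>
      hM.inter (hfl (measurableSet_singleton k))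
    have hsub : {ω | ∃ i j, i ≠ j ∧ y (Z i ω) = y (Z j ω) ∧ y (Z i ω) ≤ M} ⊆
        ⋃ k, {ω | 2 ≤ pointCount Z (B k) ω} := by
      rintro ω ⟨i, j, hij, hyij, hiM⟩
      refine mem_iUnion.2 ⟨⌊((n : ℝ) + 1) * y (Z i ω)⌋₊, ?_⟩
      have : 1 < pointCount Z (B ⌊((n : ℝ) + 1) * y (Z i ω)⌋₊) ω :=
        one_lt_encard_iff.2 ⟨i, j, ⟨hiM, rfl⟩, ⟨(hyij ▸ hiM : y (Z j ω) ≤ M), by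
          show ⌊((n : ℝ) + 1) * y (Z j ω)⌋₊ = _
          rw [hyij]⟩, hij⟩
      exact Order.add_one_le_of_lt this
    have hBT : ⋃ k, (B k ×ˢ B k) ⊆ T n := by
      intro p hp
      obtain ⟨k, hp1, hp2⟩ := mem_iUnion.1 hp
      have hn : (0 : ℝ) < n + 1 := by positivity
      have f1 : ⌊((n : ℝ) + 1) * y p.1⌋₊ = k := hp1.2
      have f2 : ⌊((n : ℝ) + 1) * y p.2⌋₊ = k := hp2.2
      rw [Nat.floor_eq_iff (mul_nonneg hn.le (hy0 _))] at f1 f2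
      show |y p.1 - y p.2| ≤ 1 / ((n : ℝ) + 1)
      rw [abs_le, ← neg_div, div_le_iff₀ hn, le_div_iff₀ hn]
      constructor <;> nlinarith
    calc P {ω | ∃ i j, i ≠ j ∧ y (Z i ω) = y (Z j ω) ∧ y (Z i ω) ≤ M}
        ≤ ∑' k, P {ω | 2 ≤ pointCount Z (B k) ω} :=
          (measure_mono hsub).trans (measure_iUnion_le _)
      _ ≤ ∑' k, (ν.prod ν) (B k ×ˢ B k) := by
          refine ENNReal.tsum_le_tsum fun k => (hZ.measure_two_le_pointCount (hB k)
            ((measure_mono inter_subset_left).trans_lt (hfin M).lt_top).ne).trans_eq ?_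
          rw [Measure.prod_prod, Measure.restrict_apply (hB k),
            inter_eq_self_of_subset_left (show B k ⊆ {z | y z ≤ M} from inter_subset_left), sq]
      _ = (ν.prod ν) (⋃ k, B k ×ˢ B k) := by
          refine (measure_iUnion (fun k l hkl => Set.disjoint_left.2 fun p hp hp' => hkl ?_)
            fun k => (hB k).prod (hB k)).symm
          exact (show _ = k from hp.1.2).symm.trans hp'.1.2
      _ ≤ (ν.prod ν) (T n) := measure_mono hBT
  have h := ae_all_iff.2 fun M => measure_eq_zero_iff_ae_notMem.1 (key M)
  filter_upwards [h] with ω hω i j hij hyij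
  obtain ⟨M, hM⟩ := exists_nat_ge (y (Z i ω))
  exact hω M ⟨i, j, hij, hyij, hM⟩

/-- Almost surely, the minimal level is attained at exactly one point. -/
lemma ae_exists_argmin (hZ : IsPoissonPointProcess Z Λ P) (hy : Measurable y)
    (hy0 : ∀ z, 0 ≤ y z) (hfin : ∀ t, Λ {z | y z ≤ t} ≠ ∞) (hnull : ∀ t, Λ {z | y z = t} = 0) :
    ∀ᵐ ω ∂P, ∃ i, ∀ j, j ≠ i → y (Z i ω) < y (Z j ω) := by
  filter_upwards [hZ.ae_finite_le hy hfin, hZ.ae_ne_of_ne hy hy0 hfin hnull] with ω h1 h2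
  obtain ⟨i, hi, hmin⟩ := exists_min_image _ (fun i => y (Z i ω)) (h1 (y (Z 0 ω)))
    ⟨0, le_refl (y (Z 0 ω))⟩
  refine ⟨i, fun j hj => lt_of_le_of_ne ?_ (h2 i j hj.symm)⟩
  by_cases hj0 : y (Z j ω) ≤ y (Z 0 ω)
  · exact hmin j hj0
  · exact (show y (Z i ω) ≤ y (Z 0 ω) from hi).trans (not_le.1 hj0).le

end Level

end IsPoissonPointProcess

/-! ### Conditioning on the exact minimum, by refining the grid -/

namespace IsPoissonPointProcess

variable {Ω E : Type*} [MeasurableSpace Ω] [MeasurableSpace E] {Z : ℕ → Ω → E} {Λ : Measure E}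
  {P : Measure Ω} [IsProbabilityMeasure P] {y : E → ℝ}

/-- Given the point of minimal level `X`, the other points are those of a Poisson process
restricted to levels above `X`. -/
theorem setLIntegral_expNeg_tsum_above [SigmaFinite Λ] (hZ : IsPoissonPointProcess Z Λ P)
    (hy : Measurable y) (hy0 : ∀ z, 0 ≤ y z) (hfin : ∀ t, Λ {z | y z ≤ t} ≠ ∞)
    (hnull : Λ {z | y z = 0} = 0) {κ : Ω → ℕ} (hκm : Measurable κ)
    (hκ : ∀ᵐ ω ∂P, ∀ j, j ≠ κ ω → y (Z (κ ω) ω) < y (Z j ω)) {γ : ℝ} (hγ : 0 < γ)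
    {C : Set E} (hC : MeasurableSet C) :
    ∫⁻ ω in {ω | Z (κ ω) ω ∈ C}, expNeg (∑' i, {i | y (Z (κ ω) ω) < y (Z i ω)}.indicator
        (fun i => logKernel γ (y (Z (κ ω) ω)) (y (Z i ω))) i) ∂P =
      ∫⁻ ω in {ω | Z (κ ω) ω ∈ C}, expNeg (∫⁻ z, {z | y (Z (κ ω) ω) < y z}.indicator
        (fun z => ratioKernel γ (y (Z (κ ω) ω)) (y z)) z ∂Λ) ∂P := by
  have hZκ : Measurable fun ω => Z (κ ω) ω :=
    (measurable_from_prod_countable_right (f := fun p : ℕ × Ω => Z p.1 p.2)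
      hZ.measurable_point).comp (hκm.prodMk measurable_id)
  -- `τ n k` is the upper end of cell `k`, so `τ n k ≤ y z` says exactly that `z` lies in a higher
  -- cell. At the minimal cell it exceeds the minimal level by at most `1 / (n + 1)`.
  let c : ℕ → E → ℕ := fun n z => ⌊((n : ℝ) + 1) * y z⌋₊
  let τ : ℕ → ℕ → ℝ := fun n k => ((k : ℝ) + 1) / ((n : ℝ) + 1)
  let f : ℕ → ℕ → E → ℝ≥0∞ := fun n k =>
    {z | τ n k ≤ y z}.indicator fun z => logKernel γ (τ n k) (y z)
  have hn : ∀ n : ℕ, (0 : ℝ) < n + 1 := fun n => by positivity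
  have hτ0 : ∀ n k, 0 < τ n k := fun n k => by positivity
  have hc : ∀ n, Measurable (c n) := fun n => by fun_prop
  have hlog : ∀ t, Measurable (logKernel γ t) := fun t =>
    (measurable_logKernel γ).comp (measurable_const.prodMk measurable_id)
  have hratio : ∀ t, Measurable (ratioKernel γ t) := fun t =>
    (measurable_ratioKernel γ).comp (measurable_const.prodMk measurable_id)
  have hf : ∀ n k, Measurable (f n k) := fun n k =>
    ((hlog _).comp hy).indicator (measurableSet_le measurable_const hy)
  have hfm : ∀ n, Measurable fun p : ℕ × E => f n p.1 p.2 := fun n =>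
    measurable_from_prod_countable_right (hf n)
  have hf0 : ∀ n k z, c n z ≤ k → f n k z = 0 := fun n k z hz => by
    refine indicator_of_notMem (fun h => ?_) _
    have h1 : ((k : ℝ) + 1) / ((n : ℝ) + 1) ≤ y z := h
    rw [div_le_iff₀ (hn n), mul_comm] at h1
    have : k + 1 ≤ c n z := Nat.le_floor (by push_cast; exact h1)
    omega
  have hf1 : ∀ n k z, 1 - expNeg (f n k z) =
      {z | τ n k ≤ y z}.indicator (fun z => ratioKernel γ (τ n k) (y z)) z := fun n k z => by
    by_cases h : τ n k ≤ y z
    · simp only [f]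
      rw [indicator_of_mem (show z ∈ {z | τ n k ≤ y z} from h),
        indicator_of_mem (show z ∈ {z | τ n k ≤ y z} from h),
        one_sub_expNeg_logKernel hγ (hτ0 n k).le ((hτ0 n k).trans_le h)]
    · simp only [f]
      rw [indicator_of_notMem (show z ∉ {z | τ n k ≤ y z} from h),
        indicator_of_notMem (show z ∉ {z | τ n k ≤ y z} from h), expNeg_zero, tsub_self]
  have hΛ : ∀ n k, Λ {z | c n z = k} ≠ ∞ := fun n k => by
    refine ((measure_mono fun z hz => ?_).trans_lt (hfin (τ n k)).lt_top).ne
    show y z ≤ ((k : ℝ) + 1) / ((n : ℝ) + 1)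
    rw [le_div_iff₀ (hn n), mul_comm, ← show c n z = k from hz]
    exact (Nat.lt_floor_add_one _).le
  have hκc : ∀ n, ∀ᵐ ω ∂P, ∀ j, c n (Z (κ ω) ω) ≤ c n (Z j ω) := fun n => by
    filter_upwards [hκ] with ω hω j
    refine Nat.floor_mono (mul_le_mul_of_nonneg_left ?_ (hn n).le)
    by_cases hj : j = κ ω
    · rw [hj]
    · exact (hω j hj).le
  let D : ℕ → Set Ω := fun n =>
    {ω | Z (κ ω) ω ∈ C ∧ ∀ j, j ≠ κ ω → c n (Z (κ ω) ω) < c n (Z j ω)}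
  have hD : ∀ n, MeasurableSet (D n) := fun n => by
    suffices h : MeasurableSet {ω | ∀ j, j ≠ κ ω → c n (Z (κ ω) ω) < c n (Z j ω)} from
      (hZκ hC).inter h
    have : {ω | ∀ j, j ≠ κ ω → c n (Z (κ ω) ω) < c n (Z j ω)} =
        ⋂ j, (κ ⁻¹' {j} ∪ {ω | c n (Z (κ ω) ω) < c n (Z j ω)}) := by
      ext ω
      simp only [mem_ofPred_eq, mem_iInter, mem_union, mem_preimage, mem_singleton_iff]
      exact forall_congr' fun j => by rw [or_iff_not_imp_left, ne_comm]
    rw [this]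
    exact MeasurableSet.iInter fun j => (hκm (measurableSet_singleton j)).union
      (measurableSet_lt ((hc n).comp hZκ) ((hc n).comp (hZ.measurable_point j)))
  have hcκ : ∀ n, Measurable fun ω => c n (Z (κ ω) ω) := fun n => (hc n).comp hZκ
  have hFm : ∀ n i, Measurable fun ω => f n (c n (Z (κ ω) ω)) (Z i ω) := fun n i =>
    Measurable.comp (g := fun p : ℕ × E => f n p.1 p.2) (f := fun ω => (c n (Z (κ ω) ω), Z i ω))
      (hfm n) ((hcκ n).prodMk (hZ.measurable_point i))
  have key := fun n => hZ.setLIntegral_expNeg_tsum_argmin (hc n) (hΛ n) (hκc n) hC (hf n) (hf0 n)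
  simp_rw [hf1] at key
  have hCm : MeasurableSet {ω | Z (κ ω) ω ∈ C} := hZκ hC
  -- Only finitely many levels lie below the minimum plus one, so there is a gap `δ` above the
  -- minimum; once `(n + 1) δ ≥ 1`, the minimum is alone in its cell.
  have hDC : ∀ᵐ ω ∂P, ∀ᶠ n in atTop, (ω ∈ D n ↔ ω ∈ {ω | Z (κ ω) ω ∈ C}) := by
    filter_upwards [hκ, hZ.ae_finite_le hy hfin] with ω hω hωf
    obtain ⟨δ, hδ, hgap⟩ : ∃ δ > 0, ∀ j, j ≠ κ ω → y (Z (κ ω) ω) + δ ≤ y (Z j ω) := by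
      have hs : ({i | y (Z i ω) ≤ y (Z (κ ω) ω) + 1} \ {κ ω}).Finite :=
        (hωf (y (Z (κ ω) ω) + 1)).sdiff
      rcases eq_empty_or_nonempty ({i | y (Z i ω) ≤ y (Z (κ ω) ω) + 1} \ {κ ω}) with he | hne
      · refine ⟨1, one_pos, fun j hj => ?_⟩
        by_contra! hlt
        exact (he ▸ (⟨hlt.le, hj⟩ : j ∈ {i | y (Z i ω) ≤ y (Z (κ ω) ω) + 1} \ {κ ω}) :
          j ∈ (∅ : Set ℕ))
      · obtain ⟨i, hi, hmin⟩ := exists_min_image _ (fun i => y (Z i ω)) hs hne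
        refine ⟨y (Z i ω) - y (Z (κ ω) ω), sub_pos.2 (hω i hi.2), fun j hj => ?_⟩
        rw [add_sub_cancel]
        by_cases h : y (Z j ω) ≤ y (Z (κ ω) ω) + 1
        · exact hmin j ⟨h, hj⟩
        · exact le_trans hi.1 (not_le.1 h).le
    obtain ⟨N, hN⟩ := exists_nat_ge (1 / δ)
    filter_upwards [eventually_ge_atTop N] with n hNn
    refine ⟨fun h => h.1, fun h => ⟨h, fun j hj => ?_⟩⟩
    have h1 : 1 ≤ ((n : ℝ) + 1) * δ := by
      rw [← div_le_iff₀ hδ]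
      exact hN.trans ((Nat.cast_le.2 hNn).trans (by linarith))
    have h2 : c n (Z (κ ω) ω) + 1 ≤ c n (Z j ω) := by
      simp only [c]
      rw [← Nat.floor_add_one (mul_nonneg (hn n).le (hy0 _))]
      refine Nat.floor_mono ?_
      nlinarith [hgap j hj, hn n]
    omega
  have hpos : ∀ᵐ ω ∂P, 0 < y (Z (κ ω) ω) := by
    filter_upwards [hZ.ae_forall_not_mem hnull] with ω hω
    exact lt_of_le_of_ne (hy0 _) fun h => hω (κ ω) h.symm
  have hτlt : ∀ ω n, y (Z (κ ω) ω) < τ n (c n (Z (κ ω) ω)) := fun ω n => by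
    simp only [τ]
    rw [lt_div_iff₀ (hn n), mul_comm]
    exact Nat.lt_floor_add_one _
  have hτlim : ∀ ω, Tendsto (fun n => τ n (c n (Z (κ ω) ω))) atTop (𝓝 (y (Z (κ ω) ω))) :=
    fun ω => by
      have hup : ∀ n, τ n (c n (Z (κ ω) ω)) ≤ y (Z (κ ω) ω) + 1 / ((n : ℝ) + 1) := fun n => by
        simp only [τ]
        rw [div_le_iff₀ (hn n), add_mul, one_div, inv_mul_cancel₀ (hn n).ne']
        have := Nat.floor_le (mul_nonneg (hn n).le (hy0 (Z (κ ω) ω)))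
        linarith
      have h2 := tendsto_one_div_add_atTop_nhds_zero_nat.const_add (y (Z (κ ω) ω))
      rw [add_zero] at h2
      exact tendsto_of_tendsto_of_tendsto_of_le_of_le tendsto_const_nhds h2
        (fun n => (hτlt ω n).le) hup
  have limit : ∀ (F : ℕ → Ω → ℝ≥0∞) (G : Ω → ℝ≥0∞), (∀ n, Measurable (F n)) →
      (∀ᵐ ω ∂P, Tendsto (fun n => F n ω) atTop (𝓝 (G ω))) →
      Tendsto (fun n => ∫⁻ ω in D n, expNeg (F n ω) ∂P) atTop
        (𝓝 (∫⁻ ω in {ω | Z (κ ω) ω ∈ C}, expNeg (G ω) ∂P)) := fun F G hF hFG => by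
    simp_rw [← lintegral_indicator (hD _), ← lintegral_indicator hCm]
    refine tendsto_lintegral_of_dominated_convergence (fun _ => 1)
      (fun n => (measurable_expNeg.comp (hF n)).indicator (hD n))
      (fun n => ae_of_all _ fun ω => (indicator_le_self _ _ ω).trans (expNeg_le_one _))
      (by simp) ?_
    filter_upwards [hDC, hFG] with ω h1 h2
    by_cases h : Z (κ ω) ω ∈ C
    · rw [indicator_of_mem (show ω ∈ {ω | Z (κ ω) ω ∈ C} from h)]
      refine ((continuous_expNeg.tendsto _).comp h2).congr' ?_
      filter_upwards [h1] with n hn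
      rw [indicator_of_mem (hn.2 h)]
      rfl
    · rw [indicator_of_notMem (show ω ∉ {ω | Z (κ ω) ω ∈ C} from h)]
      refine tendsto_const_nhds.congr fun n => ?_
      rw [indicator_of_notMem fun hn => h hn.1]
  refine tendsto_nhds_unique (limit (fun n ω => ∑' i, f n (c n (Z (κ ω) ω)) (Z i ω)) _ ?_ ?_)
    ((limit (fun n ω => ∫⁻ z, {z | τ n (c n (Z (κ ω) ω)) ≤ y z}.indicator
      (fun z => ratioKernel γ (τ n (c n (Z (κ ω) ω))) (y z)) z ∂Λ) _ ?_ ?_).congr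
      fun n => (key n).symm)
  · exact fun n => Measurable.tsum fun i => hFm n i
  · filter_upwards [hpos] with ω hω
    -- The sum over the points is an integral against the counting measure, so the same limit lemma
    -- serves both sides.
    have h := tendsto_lintegral_truncated (μ := Measure.count) (s := fun i => y (Z i ω))
      .of_discrete hlog hω (fun y hxy => continuousAt_logKernel hγ hω (hω.trans hxy))
      (fun t y hxt hxy => logKernel_le hγ hω hxt (hω.trans hxy)) (hτlt ω) (hτlim ω)
    simp_rw [lintegral_count] at h
    exact h
  · exact fun n => (Measurable.of_discrete (f := fun k => ∫⁻ z, {z | τ n k ≤ y z}.indicator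
      (fun z => ratioKernel γ (τ n k) (y z)) z ∂Λ)).comp (hcκ n)
  · filter_upwards [hpos] with ω hω
    exact tendsto_lintegral_truncated hy hratio hω
      (fun y hxy => continuousAt_ratioKernel hγ hω (hω.trans hxy))
      (fun t y hxt hxy => ratioKernel_le hγ hω hxt (hω.trans hxy)) (hτlt ω) (hτlim ω)

end IsPoissonPointProcess

/-! ### Rayleigh fading for fixed positions -/

section Fading

lemma expMeasure_Ioi {t : ℝ} (ht : 0 ≤ t) :
    expMeasure 1 (Ioi t) = ENNReal.ofReal (Real.exp (-t)) := by
  have := isProbabilityMeasure_expMeasure one_pos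
  rw [← compl_Iic, prob_compl_eq_one_sub measurableSet_Iic, ← ofReal_cdf,
    cdf_expMeasure_eq one_pos, if_pos ht, ← ENNReal.ofReal_one, ← ENNReal.ofReal_sub]
  · simp
  · simpa using ht

lemma expMeasure_lt_ofReal_mul {m : ℝ} (hm : 0 < m) (u : ℝ≥0∞) :
    expMeasure 1 {a | u < ENNReal.ofReal (a * m)} = expNeg (u * ENNReal.ofReal m⁻¹) := by
  induction u with
  | top =>
    rw [ENNReal.top_mul (by simpa using hm), expNeg_top]
    simp
  | coe u =>
    have : {a : ℝ | (u : ℝ≥0∞) < ENNReal.ofReal (a * m)} = Ioi (u * m⁻¹) := by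
      ext a
      rw [mem_Ioi, ← div_eq_mul_inv, div_lt_iff₀ hm, mem_ofPred_eq, ← ENNReal.ofReal_coe_nnreal,
        ENNReal.ofReal_lt_ofReal_iff_of_nonneg u.coe_nonneg]
    rw [this, expMeasure_Ioi (by positivity), ← ENNReal.ofReal_coe_nnreal,
      ← ENNReal.ofReal_mul u.coe_nonneg, expNeg_ofReal (by positivity)]

lemma lintegral_expNeg_expMeasure {c : ℝ} (hc : 0 ≤ c) :
    ∫⁻ a, expNeg (ENNReal.ofReal (a * c)) ∂(expMeasure 1) =
      expNeg (ENNReal.ofReal (Real.log (1 + c))) := by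
  have h1 : 0 < 1 + c := by linarith
  -- Exponential tilting: the weighted density is `1 / (1 + c)` times the exponential density of
  -- rate `1 + c`.
  have hd : ∀ a, exponentialPDF 1 a * expNeg (ENNReal.ofReal (a * c)) =
      ENNReal.ofReal (1 / (1 + c)) * exponentialPDF (1 + c) a := fun a => by
    by_cases ha : 0 ≤ a
    · rw [exponentialPDF_of_nonneg ha, exponentialPDF_of_nonneg ha, expNeg_ofReal (by positivity),
        ← ENNReal.ofReal_mul (by positivity), ← ENNReal.ofReal_mul (by positivity)]
      congr 1
      rw [mul_assoc, ← Real.exp_add]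
      field_simp
      congr 1
      ring
    · rw [exponentialPDF_of_neg (not_le.1 ha), exponentialPDF_of_neg (not_le.1 ha)]
      simp
  have hm : Measurable (exponentialPDF 1) := (measurable_exponentialPDFReal 1).ennreal_ofReal
  have he : expMeasure 1 = volume.withDensity (exponentialPDF 1) := rfl
  rw [he, lintegral_withDensity_eq_lintegral_mul _ hm (by fun_prop)]
  simp_rw [Pi.mul_apply, hd]
  rw [lintegral_const_mul' _ _ ENNReal.ofReal_ne_top, lintegral_exponentialPDF_eq_one h1,
    expNeg_ofReal (Real.log_nonneg (by linarith)), Real.exp_neg, Real.exp_log h1]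
  simp

lemma measurable_tsum_ite {Ω : Type*} [MeasurableSpace Ω] {h : ℕ → Ω → ℝ} {i : ℕ}
    (hh : ∀ j ≠ i, Measurable (h j)) (m : ℕ → ℝ) :
    Measurable fun ω => ∑' j, if j = i then 0 else ENNReal.ofReal (h j ω * m j) := by
  refine Measurable.tsum fun j => ?_
  by_cases hj : j = i
  · simp [hj]
  · simpa only [if_neg hj] using ((hh j hj).mul_const _).ennreal_ofReal

variable {Ω : Type*} [MeasurableSpace Ω] {P : Measure Ω}
  {h : ℕ → Ω → ℝ}

/-- The sum is measurable for the σ-algebra generated by the gains of index other than `i`. -/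
lemma indepFun_tsum_ite (hmeas : ∀ i, Measurable (h i)) (hindep : iIndepFun h P) (i : ℕ)
    (m : ℕ → ℝ) :
    IndepFun (h i) (fun ω => ∑' j, if j = i then 0 else ENNReal.ofReal (h j ω * m j)) P := by
  have hI := indep_iSup_of_disjoint (fun j => (hmeas j).comap_le) hindep.iIndep
    (S := {i}) (T := {i}ᶜ) disjoint_compl_right
  rw [IndepFun_iff_Indep]
  refine indep_of_indep_of_le_left (indep_of_indep_of_le_right hI ?_) ?_
  · refine Measurable.comap_le (@measurable_tsum_ite Ω
      (⨆ j ∈ ({i}ᶜ : Set ℕ), MeasurableSpace.comap (h j) inferInstance) h i (fun j hj => ?_) m)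
    refine Measurable.mono (comap_measurable (h j)) ?_ le_rfl
    exact le_iSup₂_of_le (f := fun j (_ : j ∈ ({i}ᶜ : Set ℕ)) =>
      MeasurableSpace.comap (h j) inferInstance) j hj le_rfl
  · exact le_iSup₂_of_le (f := fun j (_ : j ∈ ({i} : Set ℕ)) =>
      MeasurableSpace.comap (h j) inferInstance) i rfl le_rfl

variable [IsProbabilityMeasure P]

lemma lintegral_expNeg_tsum_exponential (hmeas : ∀ i, Measurable (h i))
    (hexp : ∀ i, P.map (h i) = expMeasure 1) (hindep : iIndepFun h P) {c : ℕ → ℝ}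
    (hc : ∀ j, 0 ≤ c j) :
    ∫⁻ ω, expNeg (∑' j, ENNReal.ofReal (h j ω * c j)) ∂P =
      expNeg (∑' j, ENNReal.ofReal (Real.log (1 + c j))) := by
  have hm : ∀ j, Measurable fun a : ℝ => expNeg (ENNReal.ofReal (a * c j)) := fun j => by fun_prop
  have key : ∀ n, ∫⁻ ω, expNeg (∑ j ∈ Finset.range n, ENNReal.ofReal (h j ω * c j)) ∂P =
      expNeg (∑ j ∈ Finset.range n, ENNReal.ofReal (Real.log (1 + c j))) := fun n => by
    simp_rw [expNeg_sum]
    have := lintegral_prod_eq_prod_lintegral_of_indepFun (Finset.range n) _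
      (hindep.comp (fun j a => expNeg (ENNReal.ofReal (a * c j))) hm)
      fun j => (hm j).comp (hmeas j)
    refine this.trans (Finset.prod_congr rfl fun j _ => ?_)
    rw [← lintegral_expNeg_expMeasure (hc j), ← hexp j, lintegral_map (hm j) (hmeas j)]
    rfl
  have h1 := tendsto_lintegral_expNeg (μ := P)
    (F := fun n ω => ∑ j ∈ Finset.range n, ENNReal.ofReal (h j ω * c j))
    (fun n => Finset.measurable_fun_sum _ fun j _ => ((hmeas j).mul_const _).ennreal_ofReal)
    fun ω => ENNReal.tendsto_nat_tsum _
  refine tendsto_nhds_unique h1 (Tendsto.congr (fun n => (key n).symm) ?_)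
  exact (continuous_expNeg.tendsto _).comp (ENNReal.tendsto_nat_tsum _)

/-- Coverage probability under Rayleigh fading, for deterministic mean powers `m`. -/
lemma measure_lt_sinr_of_mean (hmeas : ∀ i, Measurable (h i))
    (hexp : ∀ i, P.map (h i) = expMeasure 1) (hindep : iIndepFun h P) {m : ℕ → ℝ}
    (hm : ∀ j, 0 ≤ m j) {i : ℕ} (hi : 0 < m i) {N γ : ℝ} (hN : 0 ≤ N) (hγ : 0 < γ) :
    P {ω | ENNReal.ofReal γ < ENNReal.ofReal (h i ω * m i) /
        (ENNReal.ofReal N + ∑' j, if j = i then 0 else ENNReal.ofReal (h j ω * m j))} =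
      ENNReal.ofReal (Real.exp (-(γ * N * (m i)⁻¹))) *
        expNeg (∑' j, if j = i then 0 else
          ENNReal.ofReal (Real.log (1 + γ * (m i)⁻¹ * m j))) := by
  classical
  set I : Ω → ℝ≥0∞ := fun ω => ∑' j, if j = i then 0 else ENNReal.ofReal (h j ω * m j) with hI
  have hIm : Measurable I := measurable_tsum_ite (fun j _ => hmeas j) m
  let S : Set (ℝ × ℝ≥0∞) :=
    {p | ENNReal.ofReal γ * (ENNReal.ofReal N + p.2) < ENNReal.ofReal (p.1 * m i)}
  have hS : MeasurableSet S := measurableSet_lt (by fun_prop) (by fun_prop)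
  have hset : {ω | ENNReal.ofReal γ < ENNReal.ofReal (h i ω * m i) / (ENNReal.ofReal N + I ω)} =
      (fun ω => (h i ω, I ω)) ⁻¹' S := by
    ext ω
    -- Since `γ` is finite and nonzero, the equivalence persists when the denominator is `0` or `∞`.
    exact ENNReal.lt_div_iff_mul_lt (Or.inr ENNReal.ofReal_ne_top)
      (Or.inr (by simpa using hγ))
  have hcoef : ∀ b : ℝ≥0∞, ENNReal.ofReal γ * (ENNReal.ofReal N + b) * ENNReal.ofReal (m i)⁻¹ =
      ENNReal.ofReal (γ * N * (m i)⁻¹) + ENNReal.ofReal (γ * (m i)⁻¹) * b := fun b => by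
    rw [ENNReal.ofReal_mul (by positivity), ENNReal.ofReal_mul hγ.le, ENNReal.ofReal_mul hγ.le]
    ring
  have hprod := (indepFun_iff_map_prod_eq_prod_map_map (hmeas i).aemeasurable
    hIm.aemeasurable).1 (indepFun_tsum_ite hmeas hindep i m)
  have : IsProbabilityMeasure (P.map (h i)) :=
    Measure.isProbabilityMeasure_map (hmeas i).aemeasurable
  have : IsProbabilityMeasure (P.map I) := Measure.isProbabilityMeasure_map hIm.aemeasurable
  have hsec : ∀ b, (P.map (h i)) ((fun a => (a, b)) ⁻¹' S) =
      ENNReal.ofReal (Real.exp (-(γ * N * (m i)⁻¹))) *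
        expNeg (ENNReal.ofReal (γ * (m i)⁻¹) * b) := fun b => by
    have hb : (fun a => (a, b)) ⁻¹' S = {a : ℝ | ENNReal.ofReal γ * (ENNReal.ofReal N + b) <
        ENNReal.ofReal (a * m i)} := rfl
    rw [hexp i, hb, expMeasure_lt_ofReal_mul hi, hcoef, expNeg_add, expNeg_ofReal (by positivity)]
  let c : ℕ → ℝ := fun j => if j = i then 0 else γ * (m i)⁻¹ * m j
  have hc : ∀ j, 0 ≤ c j := fun j => by
    by_cases hj : j = i
    · simp [c, hj]
    · simp only [c, if_neg hj]
      exact mul_nonneg (by positivity) (hm j)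
  have hIc : ∀ ω, ENNReal.ofReal (γ * (m i)⁻¹) * I ω = ∑' j, ENNReal.ofReal (h j ω * c j) :=
    fun ω => by
      rw [hI, ← ENNReal.tsum_mul_left]
      refine tsum_congr fun j => ?_
      by_cases hj : j = i
      · simp [c, hj]
      · simp only [c, if_neg hj]
        rw [← ENNReal.ofReal_mul (by positivity)]
        congr 1
        ring
  have hlog : ∀ j, ENNReal.ofReal (Real.log (1 + c j)) =
      if j = i then 0 else ENNReal.ofReal (Real.log (1 + γ * (m i)⁻¹ * m j)) := fun j => by
    by_cases hj : j = i <;> simp [c, hj]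
  calc P {ω | ENNReal.ofReal γ < ENNReal.ofReal (h i ω * m i) / (ENNReal.ofReal N + I ω)}
      = P.map (fun ω => (h i ω, I ω)) S := by
        rw [hset, Measure.map_apply ((hmeas i).prodMk hIm) hS]
    _ = ∫⁻ b, ENNReal.ofReal (Real.exp (-(γ * N * (m i)⁻¹))) *
          expNeg (ENNReal.ofReal (γ * (m i)⁻¹) * b) ∂(P.map I) := by
        rw [hprod, Measure.prod_apply_symm hS]
        exact lintegral_congr hsec
    _ = ENNReal.ofReal (Real.exp (-(γ * N * (m i)⁻¹))) *
          ∫⁻ ω, expNeg (∑' j, ENNReal.ofReal (h j ω * c j)) ∂P := by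
        rw [lintegral_const_mul' _ _ ENNReal.ofReal_ne_top,
          lintegral_map (by fun_prop) hIm]
        simp_rw [hIc]
    _ = _ := by
        rw [lintegral_expNeg_tsum_exponential hmeas hexp hindep hc]
        simp_rw [hlog]

end Fading

/-! ### The network: path-loss levels, serving point, coverage given the positions -/

instance : DiscreteMeasurableSpace Visibility := ⟨fun _ => trivial⟩

namespace Sub6Network

variable (S : Sub6Network)

lemma gain_mul_txPower_pos : 0 < S.gain * S.txPower := mul_pos S.gain_pos S.txPower_pos

lemma measurable_visibility : Measurable S.visibility :=
  Measurable.ite (measurableSet_le measurable_norm measurable_const) measurable_const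
    measurable_const

lemma measurable_pathLoss : Measurable S.pathLoss :=
  (measurable_norm.pow (Measurable.of_discrete.comp S.measurable_visibility)).div_const _

lemma pathLoss_nonneg (z : Plane) : 0 ≤ S.pathLoss z :=
  div_nonneg (Real.rpow_nonneg (norm_nonneg z) _) S.gain_mul_txPower_pos.le

lemma meanPower_eq_inv (z : Plane) : S.meanPower z = (S.pathLoss z)⁻¹ := by
  rw [meanPower, pathLoss, Real.rpow_neg (norm_nonneg z), inv_div, div_eq_mul_inv]

lemma measurable_meanPower : Measurable S.meanPower := by
  rw [funext S.meanPower_eq_inv]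
  exact S.measurable_pathLoss.inv

/-- Path loss and state determine the norm. Hence a level set lies in two spheres and a sublevel set
in two balls, one for each state. -/
lemma norm_eq_of_pathLoss (z : Plane) : ‖z‖ =
    (S.pathLoss z * (S.gain * S.txPower)) ^ (S.exponent (S.visibility z))⁻¹ := by
  rw [pathLoss, div_mul_cancel₀ _ S.gain_mul_txPower_pos.ne',
    Real.rpow_rpow_inv (norm_nonneg z) (S.exponent_pos _).ne']

instance : SigmaFinite (ENNReal.ofReal S.density • (volume : Measure Plane)) :=
  inferInstanceAs (SigmaFinite ((S.density.toNNReal : ℝ≥0) • (volume : Measure Plane)))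

lemma measure_pathLoss_le_ne_top (t : ℝ) :
    (ENNReal.ofReal S.density • (volume : Measure Plane)) {z | S.pathLoss z ≤ t} ≠ ∞ := by
  rw [Measure.smul_apply, smul_eq_mul]
  refine ENNReal.mul_ne_top ENNReal.ofReal_ne_top ?_
  let r : Visibility → ℝ := fun v => (t * (S.gain * S.txPower)) ^ (S.exponent v)⁻¹
  refine ((measure_mono (t := Metric.closedBall 0 (r .L) ∪ Metric.closedBall 0 (r .N))
    fun z hz => ?_).trans_lt (measure_union_lt_top measure_closedBall_lt_top
      measure_closedBall_lt_top)).ne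
  have h : ‖z‖ ≤ r (S.visibility z) := by
    rw [S.norm_eq_of_pathLoss z]
    exact Real.rpow_le_rpow (mul_nonneg (S.pathLoss_nonneg z) S.gain_mul_txPower_pos.le)
      (mul_le_mul_of_nonneg_right hz S.gain_mul_txPower_pos.le)
      (inv_nonneg.2 (S.exponent_pos _).le)
  rw [mem_union, mem_closedBall_zero_iff, mem_closedBall_zero_iff]
  cases hv : S.visibility z
  · exact Or.inl (hv ▸ h)
  · exact Or.inr (hv ▸ h)

lemma measure_pathLoss_eq (t : ℝ) :
    (ENNReal.ofReal S.density • (volume : Measure Plane)) {z | S.pathLoss z = t} = 0 := by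
  rw [Measure.smul_apply, smul_eq_mul]
  refine mul_eq_zero_of_right _ ?_
  let r : Visibility → ℝ := fun v => (t * (S.gain * S.txPower)) ^ (S.exponent v)⁻¹
  refine measure_mono_null (t := Metric.sphere 0 (r .L) ∪ Metric.sphere 0 (r .N))
    (fun z hz => ?_) (measure_union_null (Measure.addHaar_sphere _ _ _)
      (Measure.addHaar_sphere _ _ _))
  have h : ‖z‖ = r (S.visibility z) := by
    rw [S.norm_eq_of_pathLoss z, show S.pathLoss z = t from hz]
  rw [mem_union, mem_sphere_zero_iff_norm, mem_sphere_zero_iff_norm]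
  cases hv : S.visibility z
  · exact Or.inl (hv ▸ h)
  · exact Or.inr (hv ▸ h)

section Measurability

variable {Ω : Type*} [MeasurableSpace Ω] {Z : ℕ → Ω → Plane} {h : ℕ → Ω → ℝ}

lemma measurable_serving (hZ : ∀ i, Measurable (Z i)) : Measurable (S.serving Z) := by
  have hp : ∀ i, MeasurableSet {ω | ∀ j, S.meanPower (Z j ω) ≤ S.meanPower (Z i ω)} := fun i => by
    have : {ω | ∀ j, S.meanPower (Z j ω) ≤ S.meanPower (Z i ω)} =
        ⋂ j, {ω | S.meanPower (Z j ω) ≤ S.meanPower (Z i ω)} := by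
      ext ω
      simp
    rw [this]
    exact MeasurableSet.iInter fun j => measurableSet_le
      (S.measurable_meanPower.comp (hZ j)) (S.measurable_meanPower.comp (hZ i))
  refine measurable_of_Iic fun n => ?_
  -- The complement accounts for configurations without a maximiser, where `sInf ∅ = 0`.
  have : S.serving Z ⁻¹' Iic n =
      (⋃ i ∈ Iic n, {ω | ∀ j, S.meanPower (Z j ω) ≤ S.meanPower (Z i ω)}) ∪
        (⋃ i, {ω | ∀ j, S.meanPower (Z j ω) ≤ S.meanPower (Z i ω)})ᶜ := by
    ext ω
    simp only [mem_preimage, mem_Iic, mem_union, mem_iUnion, mem_compl_iff, mem_ofPred_eq,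
      exists_prop]
    rcases eq_empty_or_nonempty {i | ∀ j, S.meanPower (Z j ω) ≤ S.meanPower (Z i ω)} with he | hne
    · have h0 : S.serving Z ω = 0 := by rw [serving, he, Nat.sInf_empty]
      refine iff_of_true (h0 ▸ Nat.zero_le n) (Or.inr ?_)
      rintro ⟨i, hi⟩
      exact (he ▸ (hi : i ∈ {i | ∀ j, S.meanPower (Z j ω) ≤ S.meanPower (Z i ω)}) :
        i ∈ (∅ : Set ℕ))
    · constructor
      · exact fun hn => Or.inl ⟨S.serving Z ω, hn, Nat.sInf_mem hne⟩
      · rintro (⟨i, hin, hi⟩ | hno)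
        · refine le_trans (Nat.sInf_le ?_) hin
          exact (show i ∈ {i | ∀ j, S.meanPower (Z j ω) ≤ S.meanPower (Z i ω)} from hi)
        · exact (hno hne).elim
  rw [this]
  exact (MeasurableSet.biUnion (to_countable _) fun i _ => hp i).union
    (MeasurableSet.iUnion hp).compl

lemma measurable_apply_serving {E : Type*} [MeasurableSpace E] (hZ : ∀ i, Measurable (Z i))
    {g : ℕ → Ω → E} (hg : ∀ i, Measurable (g i)) :
    Measurable fun ω => g (S.serving Z ω) ω :=
  (measurable_from_prod_countable_right (f := fun p : ℕ × Ω => g p.1 p.2) hg).comp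
    ((S.measurable_serving hZ).prodMk measurable_id)

lemma measurable_power (hZ : ∀ i, Measurable (Z i)) (hh : ∀ i, Measurable (h i)) (i : ℕ) :
    Measurable (S.power Z h i) :=
  ((hh i).mul (S.measurable_meanPower.comp (hZ i))).ennreal_ofReal

lemma measurable_sinr (hZ : ∀ i, Measurable (Z i)) (hh : ∀ i, Measurable (h i)) :
    Measurable (S.sinr Z h) := by
  have hI : Measurable (S.interference Z h) := by
    refine Measurable.tsum fun i => ?_
    exact Measurable.ite (measurableSet_eq_fun measurable_const (S.measurable_serving hZ))
      measurable_const (S.measurable_power hZ hh i)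
  exact (S.measurable_apply_serving hZ (S.measurable_power hZ hh)).div (measurable_const.add hI)

lemma measurable_serving_prod (hZ : ∀ i, Measurable (Z i)) :
    Measurable fun ω => (S.servingPathLoss Z ω, S.servingVisibility Z ω) :=
  S.measurable_apply_serving hZ fun i =>
    (S.measurable_pathLoss.comp (hZ i)).prodMk (S.measurable_visibility.comp (hZ i))

end Measurability

/-- Integral of the interference kernel over the points of path loss greater than `x`. -/
noncomputable def totalExponent (γ x : ℝ) : ℝ≥0∞ :=
  ∫⁻ z, {z | x < S.pathLoss z}.indicator (fun z => ratioKernel γ x (S.pathLoss z)) z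
    ∂(ENNReal.ofReal S.density • (volume : Measure Plane))

lemma measurable_totalExponent (γ : ℝ) : Measurable (S.totalExponent γ) := by
  have hm : Measurable fun p : ℝ × Plane =>
      {p : ℝ × Plane | p.1 < S.pathLoss p.2}.indicator
        (fun p => ratioKernel γ p.1 (S.pathLoss p.2)) p :=
    ((measurable_ratioKernel γ).comp (measurable_fst.prodMk
      (S.measurable_pathLoss.comp measurable_snd))).indicator
      (measurableSet_lt measurable_fst (S.measurable_pathLoss.comp measurable_snd))
  exact hm.lintegral_prod_right'

variable {Ω : Type*} [MeasurableSpace Ω] {P : Measure Ω} [IsProbabilityMeasure P]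
  {Z : ℕ → Ω → Plane} {h : ℕ → Ω → ℝ}

lemma sum_interferenceExponent
    (hZ : IsPoissonPointProcess Z (ENNReal.ofReal S.density • (volume : Measure Plane)) P)
    (γ x : ℝ) : ∑ v, S.interferenceExponent Z P v γ x = S.totalExponent γ x := by
  let g : ℝ → ℝ≥0∞ := (Ioi x).indicator (ratioKernel γ x)
  have hr : Measurable (ratioKernel γ x) :=
    (measurable_ratioKernel γ).comp (measurable_const.prodMk measurable_id)
  have hg : Measurable g := hr.indicator measurableSet_Ioi
  have hpm : ∀ i, Measurable fun ω => S.pathLoss (Z i ω) := fun i =>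
    S.measurable_pathLoss.comp (hZ.measurable_point i)
  have hv : ∀ v, S.interferenceExponent Z P v γ x =
      ∑' i, ∫⁻ ω in {ω | S.visibility (Z i ω) = v}, g (S.pathLoss (Z i ω)) ∂P := fun v => by
    have : S.interferenceExponent Z P v γ x = ∫⁻ y, g y ∂(S.pathLossIntensity Z P v) :=
      (lintegral_indicator measurableSet_Ioi _).symm
    rw [this, pathLossIntensity, lintegral_sum_measure]
    exact tsum_congr fun i => lintegral_map hg (hpm i)
  have hsum : ∀ F : Visibility → ℝ≥0∞, ∑ v, F v = F .L + F .N := fun F =>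
    Finset.sum_pair (by decide)
  rw [hsum, hv, hv, ← ENNReal.tsum_add]
  -- The two states partition the probability space; Campbell's formula then applies to all points
  -- at once.
  have hi : ∀ i, ∫⁻ ω in {ω | S.visibility (Z i ω) = .L}, g (S.pathLoss (Z i ω)) ∂P +
      ∫⁻ ω in {ω | S.visibility (Z i ω) = .N}, g (S.pathLoss (Z i ω)) ∂P =
      ∫⁻ ω, g (S.pathLoss (Z i ω)) ∂P := fun i => by
    have hL : MeasurableSet {ω | S.visibility (Z i ω) = .L} :=
      S.measurable_visibility.comp (hZ.measurable_point i) (measurableSet_singleton _)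
    have hc : {ω | S.visibility (Z i ω) = .N} = {ω | S.visibility (Z i ω) = .L}ᶜ := by
      ext ω
      rw [mem_compl_iff, mem_ofPred_eq, mem_ofPred_eq]
      cases S.visibility (Z i ω) <;> simp
    rw [hc, lintegral_add_compl _ hL]
  simp_rw [hi]
  exact hZ.lintegral_tsum_eq (hg.comp S.measurable_pathLoss)

/-- Almost surely, the serving point has the least path loss, strictly, and it is positive. -/
lemma ae_serving
    (hZ : IsPoissonPointProcess Z (ENNReal.ofReal S.density • (volume : Measure Plane)) P) :
    ∀ᵐ ω ∂P, (∀ i, 0 < S.pathLoss (Z i ω)) ∧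
      ∀ j, j ≠ S.serving Z ω → S.servingPathLoss Z ω < S.pathLoss (Z j ω) := by
  filter_upwards [hZ.ae_forall_not_mem (S.measure_pathLoss_eq 0),
    hZ.ae_exists_argmin S.measurable_pathLoss S.pathLoss_nonneg S.measure_pathLoss_le_ne_top
      S.measure_pathLoss_eq] with ω h0 ⟨i, hi⟩
  -- Positivity is needed for inversion to reverse the order, as `0⁻¹ = 0`.
  have hpos : ∀ i, 0 < S.pathLoss (Z i ω) := fun i =>
    lt_of_le_of_ne (S.pathLoss_nonneg _) fun h => h0 i h.symm
  have hs : {i | ∀ j, S.meanPower (Z j ω) ≤ S.meanPower (Z i ω)} = {i} := by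
    ext k
    simp only [meanPower_eq_inv, mem_ofPred_eq, mem_singleton_iff]
    constructor
    · intro hk
      by_contra hne
      exact (hk i).not_gt (inv_strictAnti₀ (hpos i) (hi k hne))
    · rintro rfl j
      by_cases hj : j = k
      · rw [hj]
      · exact inv_anti₀ (hpos k) (hi j hj).le
  have hserv : S.serving Z ω = i := by rw [serving, hs, csInf_singleton]
  refine ⟨hpos, fun j hj => ?_⟩
  rw [servingPathLoss, hserv]
  exact hi j (hserv ▸ hj)

/-- Sum of the fading exponents of the interfering points. -/
noncomputable def interferenceSum (γ : ℝ) (Z : ℕ → Ω → Plane) (ω : Ω) : ℝ≥0∞ :=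
  ∑' i, {i | S.servingPathLoss Z ω < S.pathLoss (Z i ω)}.indicator
    (fun i => logKernel γ (S.servingPathLoss Z ω) (S.pathLoss (Z i ω))) i

lemma measurable_interferenceSum (γ : ℝ) (hZ : ∀ i, Measurable (Z i)) :
    Measurable (S.interferenceSum γ Z) := by
  have hX : Measurable (S.servingPathLoss Z) := (S.measurable_serving_prod hZ).fst
  refine Measurable.tsum fun i => ?_
  have hi : Measurable fun ω => S.pathLoss (Z i ω) := S.measurable_pathLoss.comp (hZ i)
  exact Measurable.indicator (f := fun ω =>
    logKernel γ (S.servingPathLoss Z ω) (S.pathLoss (Z i ω)))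
    ((measurable_logKernel γ).comp (hX.prodMk hi)) (measurableSet_lt hX hi)

/-- Coverage probability given the positions of the points. -/
lemma measure_lt_sinr_of_points (hmeas : ∀ i, Measurable (h i))
    (hexp : ∀ i, P.map (h i) = expMeasure 1) (hindep : iIndepFun h P) {γ : ℝ} (hγ : 0 < γ) {ω : Ω}
    (hpos : ∀ i, 0 < S.pathLoss (Z i ω))
    (hlt : ∀ j, j ≠ S.serving Z ω → S.servingPathLoss Z ω < S.pathLoss (Z j ω)) :
    P {ω' | ENNReal.ofReal γ < S.sinr (fun i _ => Z i ω) h ω'} =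
      ENNReal.ofReal (Real.exp (-(γ * S.noise * S.servingPathLoss Z ω))) *
        expNeg (S.interferenceSum γ Z ω) := by
  have hm : ∀ i, 0 < S.meanPower (Z i ω) := fun i => by
    rw [meanPower_eq_inv]
    exact inv_pos.2 (hpos i)
  have key := measure_lt_sinr_of_mean hmeas hexp hindep (fun i => (hm i).le)
    (hm (S.serving Z ω)) S.noise_nonneg hγ
  have hX : (S.meanPower (Z (S.serving Z ω) ω))⁻¹ = S.servingPathLoss Z ω := by
    rw [meanPower_eq_inv, inv_inv, servingPathLoss]
  rw [hX] at key
  refine Eq.trans ?_ (key.trans ?_)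
  · rfl
  · refine congrArg (fun a => _ * expNeg a) (tsum_congr fun j => ?_)
    by_cases hj : j = S.serving Z ω
    · rw [if_pos hj, hj]
      exact (indicator_of_notMem (s := {i | S.servingPathLoss Z ω < S.pathLoss (Z i ω)})
        (lt_irrefl (S.servingPathLoss Z ω)) _).symm
    · rw [if_neg hj, indicator_of_mem (show j ∈ {i | S.servingPathLoss Z ω < S.pathLoss (Z i ω)}
        from hlt j hj), meanPower_eq_inv, ← div_eq_mul_inv]
      rfl

/-- Joint law of the serving point and of coverage, with the fading integrated out. -/
lemma measure_serving_inter_lt_sinr (hZ : ∀ i, Measurable (Z i)) (hmeas : ∀ i, Measurable (h i))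
    (hZh : IndepFun (fun ω i => Z i ω) (fun ω i => h i ω) P) (γ : ℝ) {B : Set (ℝ × Visibility)}
    (hB : MeasurableSet B) :
    P ({ω | (S.servingPathLoss Z ω, S.servingVisibility Z ω) ∈ B} ∩
        {ω | ENNReal.ofReal γ < S.sinr Z h ω}) =
      ∫⁻ ω in {ω | (S.servingPathLoss Z ω, S.servingVisibility Z ω) ∈ B},
        P {ω' | ENNReal.ofReal γ < S.sinr (fun i _ => Z i ω) h ω'} ∂P := by
  -- On the product of the spaces of positions and gains the joint law is a product measure, and the
  -- serving data depend on the first factor only; Fubini integrates the gains first.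
  let Z' : ℕ → (ℕ → Plane) × (ℕ → ℝ) → Plane := fun i p => p.1 i
  let h' : ℕ → (ℕ → Plane) × (ℕ → ℝ) → ℝ := fun i p => p.2 i
  have hZ' : ∀ i, Measurable (Z' i) := fun i => (measurable_pi_apply i).comp measurable_fst
  have hh' : ∀ i, Measurable (h' i) := fun i => (measurable_pi_apply i).comp measurable_snd
  have hZs : Measurable fun ω i => Z i ω := measurable_pi_lambda _ hZ
  have hhs : Measurable fun ω i => h i ω := measurable_pi_lambda _ hmeas
  let A : Set ((ℕ → Plane) × (ℕ → ℝ)) :=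
    {p | (S.servingPathLoss Z' p, S.servingVisibility Z' p) ∈ B} ∩
      {p | ENNReal.ofReal γ < S.sinr Z' h' p}
  have hA : MeasurableSet A := (S.measurable_serving_prod hZ' hB).inter
    (measurableSet_lt measurable_const (S.measurable_sinr hZ' hh'))
  have hprod := (indepFun_iff_map_prod_eq_prod_map_map hZs.aemeasurable hhs.aemeasurable).1 hZh
  have : IsProbabilityMeasure (P.map fun ω i => h i ω) :=
    Measure.isProbabilityMeasure_map hhs.aemeasurable
  have hBm : MeasurableSet {ω | (S.servingPathLoss Z ω, S.servingVisibility Z ω) ∈ B} :=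
    S.measurable_serving_prod hZ hB
  have h1 : P ({ω | (S.servingPathLoss Z ω, S.servingVisibility Z ω) ∈ B} ∩
      {ω | ENNReal.ofReal γ < S.sinr Z h ω}) =
      P.map (fun ω => ((fun i => Z i ω), fun i => h i ω)) A := by
    rw [Measure.map_apply (hZs.prodMk hhs) hA]
    rfl
  rw [h1, hprod, Measure.prod_apply hA, lintegral_map (measurable_measure_prodMk_left hA) hZs,
    ← lintegral_indicator hBm]
  refine lintegral_congr fun ω => ?_
  rw [Measure.map_apply hhs (measurable_prodMk_left hA)]
  by_cases hω : (S.servingPathLoss Z ω, S.servingVisibility Z ω) ∈ B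
  · rw [indicator_of_mem (show ω ∈
        {ω | (S.servingPathLoss Z ω, S.servingVisibility Z ω) ∈ B} from hω)]
    refine congrArg P (Set.ext fun ω' => ?_)
    exact ⟨fun hp => hp.2, fun hp => ⟨hω, hp⟩⟩
  · rw [indicator_of_notMem (show ω ∉
        {ω | (S.servingPathLoss Z ω, S.servingVisibility Z ω) ∈ B} from hω)]
    refine (congrArg P (Set.eq_empty_of_forall_notMem fun ω' hp => ?_)).trans measure_empty
    exact hω hp.1

end Sub6Network

/-! ### Identification of the conditional distribution -/

/-- The measures with densities `Φ` and `Ψ` have the same image under `W`. This inserts the noise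
factor, a function of the serving path loss, into the Poisson identity. -/
lemma lintegral_comp_mul_of_setLIntegral_eq {Ω β : Type*} [MeasurableSpace Ω] [MeasurableSpace β]
    {P : Measure Ω} {W : Ω → β} (hW : Measurable W) {Φ Ψ : Ω → ℝ≥0∞} (hΦ : Measurable Φ)
    (hΨ : Measurable Ψ) (h : ∀ B, MeasurableSet B → ∫⁻ ω in W ⁻¹' B, Φ ω ∂P =
      ∫⁻ ω in W ⁻¹' B, Ψ ω ∂P) {u : β → ℝ≥0∞} (hu : Measurable u) :
    ∫⁻ ω, u (W ω) * Φ ω ∂P = ∫⁻ ω, u (W ω) * Ψ ω ∂P := by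
  have hmap : (P.withDensity Φ).map W = (P.withDensity Ψ).map W := by
    ext B hB
    rw [Measure.map_apply hW hB, Measure.map_apply hW hB, withDensity_apply _ (hW hB),
      withDensity_apply _ (hW hB), h B hB]
  have key : ∀ Θ : Ω → ℝ≥0∞, Measurable Θ →
      ∫⁻ ω, u (W ω) * Θ ω ∂P = ∫⁻ b, u b ∂((P.withDensity Θ).map W) := fun Θ hΘ => by
    rw [lintegral_map hu hW, lintegral_withDensity_eq_lintegral_mul _ hΘ
      (g := fun ω => u (W ω)) (hu.comp hW)]
    exact lintegral_congr fun ω => mul_comm _ _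
  rw [key Φ hΦ, key Ψ hΨ, hmap]

theorem lemma4 {Ω : Type*} [MeasurableSpace Ω] (P : Measure Ω) [IsProbabilityMeasure P]
    (S : Sub6Network) (Z : ℕ → Ω → Plane) (h : ℕ → Ω → ℝ)
    (hZ : IsPoissonPointProcess Z (ENNReal.ofReal S.density • (volume : Measure Plane)) P)
    (hmeas : ∀ i, Measurable (h i))
    (hexp : ∀ i, P.map (h i) = expMeasure 1)
    (hindep : iIndepFun h P)
    (hZh : IndepFun (fun ω i => Z i ω) (fun ω i => h i ω) P)
    (γ : ℝ) (hγ : 0 < γ) :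
    ∀ᵐ p ∂(P.map fun ω => (S.servingPathLoss Z ω, S.servingVisibility Z ω)),
      condDistrib (S.sinr Z h) (fun ω => (S.servingPathLoss Z ω, S.servingVisibility Z ω)) P p
          (Ioi (ENNReal.ofReal γ)) =
        EReal.exp (-((γ * S.noise * p.1 : ℝ) : EReal)
          - ((∑ v' : Visibility, S.interferenceExponent Z P v' γ p.1 : ℝ≥0∞) : EReal)) := by
  let W : Ω → ℝ × Visibility := fun ω => (S.servingPathLoss Z ω, S.servingVisibility Z ω)
  have hW : Measurable W := S.measurable_serving_prod hZ.measurable_point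
  have hsinr : Measurable (S.sinr Z h) := S.measurable_sinr hZ.measurable_point hmeas
  let w : ℝ × Visibility → ℝ≥0∞ := fun p =>
    ENNReal.ofReal (Real.exp (-(γ * S.noise * p.1)))
  have hw : Measurable w := by fun_prop
  let G : ℝ × Visibility → ℝ≥0∞ := fun p => expNeg (S.totalExponent γ p.1)
  have hG : Measurable G :=
    measurable_expNeg.comp ((S.measurable_totalExponent γ).comp measurable_fst)
  have hR : ∀ p : ℝ × Visibility, EReal.exp (-((γ * S.noise * p.1 : ℝ) : EReal)
      - ((∑ v' : Visibility, S.interferenceExponent Z P v' γ p.1 : ℝ≥0∞) : EReal)) =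
      w p * G p := fun p => by
    rw [S.sum_interferenceExponent hZ, sub_eq_add_neg, EReal.exp_add, ← EReal.coe_neg,
      EReal.exp_coe]
    rfl
  simp_rw [hR]
  have hκ := S.ae_serving hZ
  have hpoisson : ∀ B, MeasurableSet B → ∫⁻ ω in W ⁻¹' B, expNeg (S.interferenceSum γ Z ω) ∂P =
      ∫⁻ ω in W ⁻¹' B, G (W ω) ∂P := fun B hB =>
    hZ.setLIntegral_expNeg_tsum_above S.measurable_pathLoss S.pathLoss_nonneg
      S.measure_pathLoss_le_ne_top (S.measure_pathLoss_eq 0)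
      (S.measurable_serving hZ.measurable_point) (hκ.mono fun ω hω => hω.2) hγ
      (C := (fun z => (S.pathLoss z, S.visibility z)) ⁻¹' B)
      (S.measurable_pathLoss.prodMk S.measurable_visibility hB)
  have : IsProbabilityMeasure (P.map W) := Measure.isProbabilityMeasure_map hW.aemeasurable
  -- Both sides are measurable in `(x, v)`, so it suffices to compare their integrals over every
  -- measurable set `B` of serving data.
  refine ae_eq_of_forall_setLIntegral_eq_of_sigmaFinite
    (Kernel.measurable_coe _ measurableSet_Ioi) (hw.mul hG) fun B hB _ => ?_
  rw [setLIntegral_map hB (Kernel.measurable_coe _ measurableSet_Ioi) hW,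
    setLIntegral_preimage_condDistrib hW hsinr.aemeasurable measurableSet_Ioi hB,
    setLIntegral_map (f := fun p => w p * G p) hB (hw.mul hG) hW]
  calc P (W ⁻¹' B ∩ S.sinr Z h ⁻¹' Ioi (ENNReal.ofReal γ))
      = ∫⁻ ω in W ⁻¹' B, P {ω' | ENNReal.ofReal γ < S.sinr (fun i _ => Z i ω) h ω'} ∂P :=
        S.measure_serving_inter_lt_sinr hZ.measurable_point hmeas hZh γ hB
    _ = ∫⁻ ω in W ⁻¹' B, w (W ω) * expNeg (S.interferenceSum γ Z ω) ∂P := by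
        refine lintegral_congr_ae (ae_restrict_of_ae ?_)
        filter_upwards [hκ] with ω hω
        exact S.measure_lt_sinr_of_points hmeas hexp hindep hγ hω.1 hω.2
    _ = ∫⁻ ω in W ⁻¹' B, w (W ω) * G (W ω) ∂P := by
        refine lintegral_comp_mul_of_setLIntegral_eq hW
          (measurable_expNeg.comp (S.measurable_interferenceSum γ hZ.measurable_point))
          (hG.comp hW) (fun C hC => ?_) hw
        -- The Poisson identity is needed under `P` restricted to `W ⁻¹' B`, that is, on `C ∩ B`.
        rw [Measure.restrict_restrict (hW hC), ← preimage_inter]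
        exact hpoisson _ (hC.inter hB)
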